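/- **Setting.** Terms of the linear substitution calculus are $t,u ::= x \mid \lambda x.t \mid tu \mid t[x{\leftarrow}u]$, up to $\alpha$-equivalence, where $t[x{\leftarrow}u]$ binds $x$ in $t$ but not in $u$. Contexts $C$ are terms with exactly one hole $\langle\cdot\rangle$; plugging $C\langle t\rangle$, $C\langle D\rangle$ may capture variables. The level of $C$ is the number of arguments (right-hand sides of applications) and of right-hand sides of substitutions $[x{\leftarrow}\cdot]$ that contain the hole; $C_n,D_n$ denote contexts of level $n$. Head contexts $H$ are the contexts of level $0$; substitution contexts are $S ::= \langle\cdot\rangle \mid S[x{\leftarrow}t]$. Linear head evaluation $\multimap$ is the closure under head contexts ($H\langle t\rangle\multimap H\langle u\rangle$ if $t\mapsto u$) of the rules $$S\langle\lambda x.t\rangle u\mapsto S\langle t[x{\leftarrow}u]\rangle,\qquad H\langle x\rangle[x{\leftarrow}t]\mapsto H\langle t\rangle[x{\leftarrow}t],\qquad t[x{\leftarrow}u]\mapsto t\ \text{ if } x\notin \mathrm{fv}(t),$$ where in the first two rules $S$ (resp. $H$) captures no free variable of $u$ (resp. of $t$), and the displayed occurrence of $x$ in $H\langle x\rangle$ is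 bound by the displayed substitution. A logged position is a triple $(t,C_n,L_n)$ where $L_n$ is a list of $n$ logged positions (a log). A state of the $\lambda$-IAM is $(t,C,L,T,d)$ with $t$ a term, $C$ a context, $L$ a list of logged positions, the tape $T$ a list of logged positions and symbols $\mathsf p$, and $d\in\{\downarrow,\uparrow\}$. With $\ell$ ranging over logged positions, $L_n$ over logs of length $n$, and the displayed $x$ bound by the displayed binder, the transitions are: - $(tu,C,L,T,\downarrow)\to(t,C\langle\langle\cdot\rangle u\rangle,L,\mathsf p\cdot T,\downarrow)$; - $(\lambda x.t,C,L,\mathsf p\cdot T,\downarrow)\to(t,C\langle\lambda x.\langle\cdot\rangle\rangle,L,T,\downarrow)$; - $(x,C\langle\lambda x.D_n\rangle,L_n\cdot L,T,\downarrow)\to(\lambda x.D_n\langle x\rangle,C,L,(x,\lambda x.D_n,L_n)\cdot T,\uparrow)$; - $(\lambda x.D_n\langle x\rangle,C,L,(x,\lambda x.D_n,L_n)\cdot T,\downarrow)\to(x,C\langle\lambda x.D_n\rangle,L_n\cdot L,T,\uparrow)$; - $(t,C\langle\langle\cdot\rangle u\rangle,L,\mathsf p\cdot T,\uparrow)\to(tu,C,L,T,\uparrow)$;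 - $(t,C\langle\lambda x.\langle\cdot\rangle\rangle,L,T,\uparrow)\to(\lambda x.t,C,L,\mathsf p\cdot T,\uparrow)$; - $(t,C\langle\langle\cdot\rangle u\rangle,L,\ell\cdot T,\uparrow)\to(u,C\langle t\langle\cdot\rangle\rangle,\ell\cdot L,T,\downarrow)$; - $(u,C\langle t\langle\cdot\rangle\rangle,\ell\cdot L,T,\uparrow)\to(t,C\langle\langle\cdot\rangle u\rangle,L,\ell\cdot T,\downarrow)$; - $(t[x{\leftarrow}u],C,L,T,\downarrow)\to(t,C\langle\langle\cdot\rangle[x{\leftarrow}u]\rangle,L,T,\downarrow)$; - $(x,C\langle D_n[x{\leftarrow}u]\rangle,L_n\cdot L,T,\downarrow)\to(u,C\langle D_n\langle x\rangle[x{\leftarrow}\langle\cdot\rangle]\rangle,(x,D_n[x{\leftarrow}u],L_n)\cdot L,T,\downarrow)$; - $(t,C\langle\langle\cdot\rangle[x{\leftarrow}u]\rangle,L,T,\uparrow)\to(t[x{\leftarrow}u],C,L,T,\uparrow)$; - $(u,C\langle D_n\langle x\rangle[x{\leftarrow}\langle\cdot\rangle]\rangle,(x,D_n[x{\leftarrow}u],L_n)\cdot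 L,T,\uparrow)\to(x,C\langle D_n[x{\leftarrow}u]\rangle,L_n\cdot L,T,\uparrow)$. For a term $t$ and $k\ge 0$, let $|t|_k\in\mathbb N\cup\{\infty\}$ be the length of the maximal sequence of transitions from the initial state $(t,\langle\cdot\rangle,\epsilon,\mathsf p^k,\downarrow)$ if the machine terminates, and $|t|_k=\infty$ if it diverges. **Lemma (the length of terminating runs strictly decreases along $\multimap$).** Let $t\multimap u$. There exists $k\ge 0$ such that for every $h\ge k$ with $|t|_h\neq\infty$ one has $|t|_h>|u|_h$. -/

import Mathlib

namespace LIAM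

/-- Terms of the linear substitution calculus, modulo α-equivalence, in de Bruijn notation.
An index that points beyond all the enclosing binders is a free variable. -/
inductive Tm : Type
  | var (i : ℕ) : Tm
  | lam (t : Tm) : Tm
  | app (t u : Tm) : Tm
  /-- The explicit substitution `t[x←u]`: it binds index `0` in `t` and nothing in `u`. -/
  | es (t u : Tm) : Tm

/-- Add `d` to all the variables of a term that are free above the first `c` indices. -/
def Tm.lift (d : ℕ) : ℕ → Tm → Tm
  | c, .var i => if i < c then .var i else .var (i + d)
  | c, .lam t => .lam (Tm.lift d (c + 1) t)
  | c, .app t u => .app (Tm.lift d c t) (Tm.lift d c u)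
  | c, .es t u => .es (Tm.lift d (c + 1) t) (Tm.lift d c u)

/-- `t` moved under `d` further binders, none of which captures a variable of `t`. -/
def Tm.shift (d : ℕ) (t : Tm) : Tm := Tm.lift d 0 t

/-- Contexts: terms with exactly one hole. -/
inductive Ctx : Type
  | hole : Ctx
  | lam (C : Ctx) : Ctx
  | appL (C : Ctx) (t : Tm) : Ctx
  | appR (t : Tm) (C : Ctx) : Ctx
  | esL (C : Ctx) (t : Tm) : Ctx
  | esR (t : Tm) (C : Ctx) : Ctx

namespace Ctx

/-- Plugging of a term in a context; variables of the term may be captured. -/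
def plug : Ctx → Tm → Tm
  | hole, s => s
  | lam C, s => .lam (C.plug s)
  | appL C t, s => .app (C.plug s) t
  | appR t C, s => .app t (C.plug s)
  | esL C t, s => .es (C.plug s) t
  | esR t C, s => .es t (C.plug s)

/-- Plugging `C⟨D⟩` of a context `D` in a context `C`. -/
def comp : Ctx → Ctx → Ctx
  | hole, D => D
  | lam C, D => lam (C.comp D)
  | appL C t, D => appL (C.comp D) t
  | appR t C, D => appR t (C.comp D)
  | esL C t, D => esL (C.comp D) t
  | esR t C, D => esR t (C.comp D)

/-- The level of a context: the number of arguments and of explicit substitutions in which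
the hole lies. -/
def level : Ctx → ℕ
  | hole => 0
  | lam C => C.level
  | appL C _ => C.level
  | appR _ C => C.level + 1
  | esL C _ => C.level
  | esR _ C => C.level + 1

/-- The number of binders that have the hole in their scope. Hence `var D.binders` in the hole
of `D` is the variable bound by a binder placed immediately above `D`. -/
def binders : Ctx → ℕ
  | hole => 0
  | lam C => C.binders + 1
  | appL C _ => C.binders
  | appR _ C => C.binders
  | esL C _ => C.binders + 1
  | esR _ C => C.binders

/-- Head contexts are the contexts of level `0`. -/
def IsHead (H : Ctx) : Prop := H.level = 0

/-- Substitution contexts: `S ::= ⟨·⟩ | S[x←t]`. -/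
inductive IsSubst : Ctx → Prop
  | hole : IsSubst hole
  | esL (S : Ctx) (t : Tm) : IsSubst S → IsSubst (esL S t)

end Ctx

open Ctx in
/-- The rules of linear head evaluation at top level. -/
inductive RootStep : Tm → Tm → Prop
  /-- `S⟨λx.t⟩ u ↦ S⟨t[x←u]⟩`, where `S` captures no variable of `u`. -/
  | dB (S : Ctx) (t u : Tm) : S.IsSubst →
      RootStep (.app (S.plug (.lam t)) u) (S.plug (.es t (u.shift S.binders)))
  /-- `H⟨x⟩[x←t] ↦ H⟨t⟩[x←t]`, where `x` is bound by the displayed substitution, and `H`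
  captures no variable of `t`. -/
  | ls (H : Ctx) (t : Tm) : H.IsHead →
      RootStep (.es (H.plug (.var H.binders)) t) (.es (H.plug (t.shift (H.binders + 1))) t)
  /-- `t[x←u] ↦ t` if `x` is not free in `t`, that is, if the body of the explicit
  substitution is `t` moved under the binder of `x`. -/
  | gc (t u : Tm) : RootStep (.es (t.shift 1) u) t

/-- Linear head evaluation `⊸`: the closure of the top level rules by head contexts. -/
inductive LinearHead : Tm → Tm → Prop
  | head (H : Ctx) (t u : Tm) : H.IsHead → RootStep t u → LinearHead (H.plug t) (H.plug u)

/-- Logged positions `(t, C, L)`; a log is a list of logged positions. That the length of `L`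
is the level of `C` is enforced by the transitions that create and consume logged positions. -/
inductive LPos : Type
  | mk (t : Tm) (C : Ctx) (L : List LPos) : LPos

/-- The elements of a tape: the symbol `p` and logged positions. -/
inductive TapeElem : Type
  | p : TapeElem
  | pos (l : LPos) : TapeElem

inductive Dir : Type
  | down : Dir
  | up : Dir

/-- States of the abstract machine. -/
structure State : Type where
  code : Tm
  ctx : Ctx
  log : List LPos
  tape : List TapeElem
  dir : Dir

open Ctx in
/-- The transitions of the Lambda Interaction Abstract Machine on terms of the linear
substitution calculus. -/
inductive Step : State → State → Prop
  | dot1 (t u : Tm) (C : Ctx) (L : List LPos) (T : List TapeElem) :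
      Step ⟨.app t u, C, L, T, .down⟩
        ⟨t, C.comp (appL hole u), L, .p :: T, .down⟩
  | dot2 (t : Tm) (C : Ctx) (L : List LPos) (T : List TapeElem) :
      Step ⟨.lam t, C, L, .p :: T, .down⟩
        ⟨t, C.comp (lam hole), L, T, .down⟩
  | var (C D : Ctx) (Ln L : List LPos) (T : List TapeElem) : Ln.length = D.level →
      Step ⟨.var D.binders, C.comp (lam D), Ln ++ L, T, .down⟩
        ⟨.lam (D.plug (.var D.binders)), C, L,
          .pos (.mk (.var D.binders) (lam D) Ln) :: T, .up⟩
  | bt2 (C D : Ctx) (Ln L : List LPos) (T : List TapeElem) : Ln.length = D.level →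
      Step ⟨.lam (D.plug (.var D.binders)), C, L,
          .pos (.mk (.var D.binders) (lam D) Ln) :: T, .down⟩
        ⟨.var D.binders, C.comp (lam D), Ln ++ L, T, .up⟩
  | dot3 (t u : Tm) (C : Ctx) (L : List LPos) (T : List TapeElem) :
      Step ⟨t, C.comp (appL hole u), L, .p :: T, .up⟩
        ⟨.app t u, C, L, T, .up⟩
  | dot4 (t : Tm) (C : Ctx) (L : List LPos) (T : List TapeElem) :
      Step ⟨t, C.comp (lam hole), L, T, .up⟩
        ⟨.lam t, C, L, .p :: T, .up⟩
  | arg (t u : Tm) (C : Ctx) (l : LPos) (L : List LPos) (T : List TapeElem) :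
      Step ⟨t, C.comp (appL hole u), L, .pos l :: T, .up⟩
        ⟨u, C.comp (appR t hole), l :: L, T, .down⟩
  | bt1 (t u : Tm) (C : Ctx) (l : LPos) (L : List LPos) (T : List TapeElem) :
      Step ⟨u, C.comp (appR t hole), l :: L, T, .up⟩
        ⟨t, C.comp (appL hole u), L, .pos l :: T, .down⟩
  | es (t u : Tm) (C : Ctx) (L : List LPos) (T : List TapeElem) :
      Step ⟨.es t u, C, L, T, .down⟩
        ⟨t, C.comp (esL hole u), L, T, .down⟩
  | var2 (u : Tm) (C D : Ctx) (Ln L : List LPos) (T : List TapeElem) : Ln.length = D.level →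
      Step ⟨.var D.binders, C.comp (esL D u), Ln ++ L, T, .down⟩
        ⟨u, C.comp (esR (D.plug (.var D.binders)) hole),
          .mk (.var D.binders) (esL D u) Ln :: L, T, .down⟩
  | es2 (t u : Tm) (C : Ctx) (L : List LPos) (T : List TapeElem) :
      Step ⟨t, C.comp (esL hole u), L, T, .up⟩
        ⟨.es t u, C, L, T, .up⟩
  | var3 (u : Tm) (C D : Ctx) (Ln L : List LPos) (T : List TapeElem) : Ln.length = D.level →
      Step ⟨u, C.comp (esR (D.plug (.var D.binders)) hole),
          .mk (.var D.binders) (esL D u) Ln :: L, T, .up⟩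
        ⟨.var D.binders, C.comp (esL D u), Ln ++ L, T, .up⟩

/-- `Steps n s s'`: a run of `n` transitions leads from `s` to `s'`. -/
inductive Steps : ℕ → State → State → Prop
  | refl (s : State) : Steps 0 s s
  | tail (n : ℕ) (s s' s'' : State) : Steps n s s' → Step s' s'' → Steps (n + 1) s s''

/-- The initial state of code `t` and depth `k`. -/
def init (t : Tm) (k : ℕ) : State := ⟨t, .hole, [], List.replicate k .p, .down⟩

/-- The length `|t|_k` of the run from the initial state of code `t` and depth `k`: the maximal
number of transitions, and `⊤` if the machine diverges (the machine is deterministic). -/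
noncomputable def runLength (t : Tm) (k : ℕ) : ℕ∞ :=
  ⨆ (n : ℕ) (_ : ∃ s, Steps n (init t k) s), (n : ℕ∞)

end LIAM

/-! The machine on the reduct is simulated by the machine on the redex: every transition on `u` is
matched by a nonempty run on `t`, between states related by an explicit map. Moreover, the two runs
first descend to the address where the terms differ, and there `t` has to make at least one further
transition before it is in the image of the state of `u`. So every run of `u` is exceeded in length
by some run of `t`; if `|t|_h` is finite, this is the strict inequality. The descent consumes one
`p` per abstraction that it crosses, hence the lower bound on the depth.

The simulation is much simpler if positions are absolute addresses in a fixed term: a state then has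
no context, and half of the rules (`PFwd`) are the reversals of the other half. The price is that a
concrete logged position only remembers the context below its binder. A concrete backtracking step
is thus also an absolute one only if the binder that was logged is the one where the machine stands.
This is the invariant `Good`: from every logged position, on the tape or in the log, a search run
leads back to its binder. `Conc.step_inv` and `Conc.step` then identify the two machines on
reachable states.

`Local` lists what a local change of the term must satisfy to give a simulation, and `Local.sim` and
`Local.runLength_lt` derive the inequality from it. For `gc` and `ls` the changed subterm of `u` is
simulated by a subterm of `t` elsewhere (`Local.ofCopy`); in `ls` the copy is simulated by the
original in the substitution, with one more entry in the log. For `dB` (`Local.dB`) body,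
substitution context and argument are sent to their places in the redex, and the tape carries an
extra `p` until the abstraction is crossed. -/

namespace LIAM

/-! ### Addresses, binders and levels -/

/-- The steps from a node of the syntax tree of a term to its children. -/
inductive Sym : Type
  | lam | appL | appR | esL | esR
  deriving DecidableEq

/-- The number of binders crossed by a step into a child. -/
def Sym.binds : Sym → ℕ
  | .lam => 1
  | .appL => 0
  | .appR => 0
  | .esL => 1
  | .esR => 0

/-- The number of levels crossed by a step into a child. -/
def Sym.lev : Sym → ℕ
  | .lam => 0
  | .appL => 0
  | .appR => 1
  | .esL => 0
  | .esR => 1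

/-- The absolute address of a subterm. -/
abbrev Path := List Sym

/-- The number of binders crossed by a path. -/
def nb : Path → ℕ
  | [] => 0
  | x :: q => x.binds + nb q

/-- The level of a path. -/
def nl : Path → ℕ
  | [] => 0
  | x :: q => x.lev + nl q

@[simp] theorem nb_nil : nb [] = 0 := rfl
@[simp] theorem nl_nil : nl [] = 0 := rfl
@[simp] theorem nb_cons (x : Sym) (q : Path) : nb (x :: q) = x.binds + nb q := rfl
@[simp] theorem nl_cons (x : Sym) (q : Path) : nl (x :: q) = x.lev + nl q := rfl
@[simp] theorem binds_lam : Sym.lam.binds = 1 := rfl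
@[simp] theorem binds_appL : Sym.appL.binds = 0 := rfl
@[simp] theorem binds_appR : Sym.appR.binds = 0 := rfl
@[simp] theorem binds_esL : Sym.esL.binds = 1 := rfl
@[simp] theorem binds_esR : Sym.esR.binds = 0 := rfl
@[simp] theorem lev_lam : Sym.lam.lev = 0 := rfl
@[simp] theorem lev_appL : Sym.appL.lev = 0 := rfl
@[simp] theorem lev_appR : Sym.appR.lev = 1 := rfl
@[simp] theorem lev_esL : Sym.esL.lev = 0 := rfl
@[simp] theorem lev_esR : Sym.esR.lev = 1 := rfl

@[simp] theorem nb_append (p q : Path) : nb (p ++ q) = nb p + nb q := by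
  induction p with
  | nil => simp
  | cons x p ih => simp [ih, add_assoc]

@[simp] theorem nl_append (p q : Path) : nl (p ++ q) = nl p + nl q := by
  induction p with
  | nil => simp
  | cons x p ih => simp [ih, add_assoc]

/-- Two binders of one address with the same number of binders below them coincide. -/
theorem binder_unique {b b' d d' : Path} {x x' : Sym} (h : b ++ x :: d = b' ++ x' :: d')
    (hx : x.binds = 1) (hx' : x'.binds = 1) (hd : nb d = nb d') :
    b = b' ∧ x = x' ∧ d = d' := by
  rcases List.append_eq_append_iff.1 h with ⟨a, h1, h2⟩ | ⟨a, h1, h2⟩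
  · cases a with
    | nil => simp at h1 h2; exact ⟨h1.symm, h2.1, h2.2⟩
    | cons y a =>
      simp only [List.cons_append, List.cons.injEq] at h2
      obtain ⟨rfl, rfl⟩ := h2
      simp at hd
      omega
  · cases a with
    | nil => simp at h1 h2; exact ⟨h1, h2.1.symm, h2.2.symm⟩
    | cons y a =>
      simp only [List.cons_append, List.cons.injEq] at h2
      obtain ⟨rfl, rfl⟩ := h2
      simp at hd
      omega

/-- The constructor at the root of a term. -/
inductive Kind : Type
  | var (i : ℕ) | lam | app | es

/-- The constructor of a term at an address. -/
def kindAt : Tm → Path → Option Kind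
  | .var i, [] => some (.var i)
  | .lam _, [] => some .lam
  | .app _ _, [] => some .app
  | .es _ _, [] => some .es
  | .lam t, .lam :: q => kindAt t q
  | .app t _, .appL :: q => kindAt t q
  | .app _ u, .appR :: q => kindAt u q
  | .es t _, .esL :: q => kindAt t q
  | .es _ u, .esR :: q => kindAt u q
  | _, _ => none

/-- The constructors that have a child in a given direction. -/
def Sym.parent : Sym → Kind
  | .lam => .lam
  | .appL => .app
  | .appR => .app
  | .esL => .es
  | .esR => .es

attribute [simp] Sym.parent

theorem kindAt_parent {w : Tm} {b d : Path} {x : Sym} {k : Kind}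
    (h : kindAt w (b ++ x :: d) = some k) : kindAt w b = some x.parent := by
  induction b generalizing w with
  | nil => cases w <;> cases x <;> simp_all [kindAt]
  | cons y b ih => cases w <;> cases y <;> simp_all [kindAt]

/-! ### The machine on absolute addresses: determinism and reversibility -/

/-- Logged positions with absolute addresses: of the binder and of the variable. -/
inductive LP : Type
  | mk (b v : Path) (Ln : List LP) : LP

/-- Tapes with absolute addresses. -/
inductive PTape : Type
  | p : PTape
  | pos (l : LP) : PTape

def Dir.flip : Dir → Dir
  | .down => .up
  | .up => .down

@[simp] theorem Dir.flip_down : Dir.down.flip = .up := rfl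
@[simp] theorem Dir.flip_up : Dir.up.flip = .down := rfl
@[simp] theorem Dir.flip_flip (d : Dir) : d.flip.flip = d := by cases d <;> rfl

/-- States of the machine on a fixed term, with absolute addresses. -/
structure PState : Type where
  path : Path
  log : List LP
  tape : List PTape
  dir : Dir

def PState.flip (s : PState) : PState := ⟨s.path, s.log, s.tape, s.dir.flip⟩

@[simp] theorem PState.flip_mk (q : Path) (L : List LP) (T : List PTape) (d : Dir) :
    PState.flip ⟨q, L, T, d⟩ = ⟨q, L, T, d.flip⟩ := rfl

@[simp] theorem PState.flip_flip (s : PState) : s.flip.flip = s := by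
  cases s; simp

/-- One half of the transitions on absolute addresses; the others are their inverses. -/
inductive PFwd (w : Tm) : PState → PState → Prop
  | app (q : Path) (L : List LP) (T : List PTape) : kindAt w q = some .app →
      PFwd w ⟨q, L, T, .down⟩ ⟨q ++ [.appL], L, .p :: T, .down⟩
  | lam (q : Path) (L : List LP) (T : List PTape) : kindAt w q = some .lam →
      PFwd w ⟨q, L, .p :: T, .down⟩ ⟨q ++ [.lam], L, T, .down⟩
  | es (q : Path) (L : List LP) (T : List PTape) : kindAt w q = some .es →
      PFwd w ⟨q, L, T, .down⟩ ⟨q ++ [.esL], L, T, .down⟩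
  | var (b d : Path) (Ln L : List LP) (T : List PTape) :
      kindAt w (b ++ .lam :: d) = some (.var (nb d)) → Ln.length = nl d →
      PFwd w ⟨b ++ .lam :: d, Ln ++ L, T, .down⟩
        ⟨b, L, .pos (.mk b (b ++ .lam :: d) Ln) :: T, .up⟩
  | sub (b d : Path) (Ln L : List LP) (T : List PTape) :
      kindAt w (b ++ .esL :: d) = some (.var (nb d)) → Ln.length = nl d →
      PFwd w ⟨b ++ .esL :: d, Ln ++ L, T, .down⟩
        ⟨b ++ [.esR], .mk b (b ++ .esL :: d) Ln :: L, T, .down⟩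
  | arg (q : Path) (l : LP) (L : List LP) (T : List PTape) : kindAt w q = some .app →
      PFwd w ⟨q ++ [.appL], L, .pos l :: T, .up⟩ ⟨q ++ [.appR], l :: L, T, .down⟩

/-- The transitions on absolute addresses. -/
def PStep (w : Tm) (s s' : PState) : Prop := PFwd w s s' ∨ PFwd w s'.flip s.flip

theorem PStep.flip {w : Tm} {s s' : PState} (h : PStep w s s') : PStep w s'.flip s.flip := by
  rcases h with h | h
  · right; simpa using h
  · left; exact h

/-- The index of a variable counts the binders between it and its own binder, so `binder_unique`
determines the latter; the level of the path in between then determines where the log is cut. -/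
theorem PFwd.det {w : Tm} {s a b : PState} (h : PFwd w s a) (h' : PFwd w s b) : a = b := by
  cases h <;> generalize hs : PState.mk _ _ _ _ = s at h' <;> cases h' <;>
    simp only [PState.mk.injEq, reduceCtorEq, and_false, and_true] at hs ⊢
  all_goals try (simp_all; done)
  all_goals
    obtain ⟨h1, h2, h6⟩ := hs
    obtain ⟨h3, h4, h5⟩ := binder_unique h1 rfl rfl (by simp_all)
    have := List.append_inj h2 (by simp_all)
    simp_all

/-- The rules and their reversals have disjoint domains. Direction and top of the tape separate most
pairs; in the others the reversed rule is `var`, which starts at an abstraction, where the competing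
rule does not apply. -/
theorem PFwd.not_rev {w : Tm} {s a b : PState} (h : PFwd w s a) (h' : PFwd w b s.flip) :
    False := by
  cases h <;> simp only [PState.flip_mk, Dir.flip_down, Dir.flip_up] at h' <;>
    generalize hs : PState.mk _ _ _ _ = s at h' <;> cases h' <;>
    simp only [PState.mk.injEq, reduceCtorEq, and_false, and_true] at hs
  all_goals try (simp_all; done)
  all_goals
    rename_i hk _
    have := kindAt_parent hk
    simp_all

/-- A logged position records binder, variable and intermediate log, so nothing is lost when a
variable is left. -/
theorem PFwd.codet {w : Tm} {s a b : PState} (h : PFwd w a s) (h' : PFwd w b s) : a = b := by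
  cases h <;> generalize hs : PState.mk _ _ _ _ = s at h' <;> cases h' <;>
    simp only [PState.mk.injEq, reduceCtorEq, and_false, and_true] at hs ⊢
  all_goals try (simp_all; done)
  all_goals simp only [LP.mk.injEq, PTape.pos.injEq, List.cons.injEq] at hs
  · obtain ⟨rfl, rfl, ⟨-, h1, rfl⟩, rfl⟩ := hs
    simpa using h1
  · obtain ⟨-, ⟨⟨rfl, h1, rfl⟩, rfl⟩, rfl⟩ := hs
    simpa using h1

theorem PStep.det {w : Tm} {s a b : PState} (h : PStep w s a) (h' : PStep w s b) : a = b := by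
  rcases h with h | h <;> rcases h' with h' | h'
  · exact h.det h'
  · exact (h.not_rev h').elim
  · exact (h'.not_rev h).elim
  · have := h.codet h'
    rw [← a.flip_flip, this, b.flip_flip]

/-- Runs of the machine on absolute addresses. -/
inductive PRun (w : Tm) : ℕ → PState → PState → Prop
  | refl (s : PState) : PRun w 0 s s
  | head {n : ℕ} {s s' s'' : PState} : PStep w s s' → PRun w n s' s'' → PRun w (n + 1) s s''

theorem PRun.trans {w : Tm} {m n : ℕ} {s s' s'' : PState} (h : PRun w m s s')
    (h' : PRun w n s' s'') : PRun w (m + n) s s'' := by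
  induction h with
  | refl s => simpa using h'
  | head h1 _ ih => rw [Nat.add_right_comm]; exact .head h1 (ih h')

theorem PStep.run {w : Tm} {s s' : PState} (h : PStep w s s') : PRun w 1 s s' :=
  .head h (.refl _)

theorem PFwd.run {w : Tm} {s s' : PState} (h : PFwd w s s') : PRun w 1 s s' :=
  PStep.run (.inl h)

theorem PRun.flip {w : Tm} {n : ℕ} {s s' : PState} (h : PRun w n s s') :
    PRun w n s'.flip s.flip := by
  induction h with
  | refl s => exact .refl _
  | head h1 _ ih => exact ih.trans h1.flip.run

/-- Two runs from one state: the longer one extends the shorter one. -/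
theorem PRun.split {w : Tm} {m n : ℕ} {s a b : PState} (h : PRun w m s a)
    (h' : PRun w (m + n) s b) : PRun w n a b := by
  induction h with
  | refl s => simpa using h'
  | head h1 _ ih =>
    rw [Nat.add_right_comm] at h'
    cases h' with
    | head h2 h3 =>
      cases h1.det h2
      exact ih h3

/-- By determinism, a run to a final state passes through the successor of its starting point. -/
theorem PRun.tail_of_final {w : Tm} {n : ℕ} {s a b : PState} (h : PRun w n s b)
    (hb : ∀ c, ¬ PStep w b c) (h' : PStep w s a) : ∃ m, PRun w m a b := by
  cases h with
  | refl => exact (hb _ h').elim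
  | head h1 h2 => cases h1.det h'; exact ⟨_, h2⟩

theorem not_step_of_lam {w : Tm} {b : Path} {L : List LP} (h : kindAt w b = some .lam)
    (c : PState) : ¬ PStep w ⟨b, L, [], .down⟩ c := by
  rintro (h' | h')
  · generalize hs : PState.mk _ _ _ _ = s at h'
    cases h' <;> simp_all
  · obtain ⟨q, L', T, d⟩ := c
    simp only [PState.flip_mk, Dir.flip_down] at h'
    generalize d.flip = e at h'
    cases h'

/-! ### The backtracking invariant -/

/-- The variable of a logged position is bound by its abstraction. -/
def LP.IsLam (w : Tm) : LP → Prop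
  | .mk b v Ln => ∃ d, v = b ++ .lam :: d ∧ kindAt w v = some (.var (nb d)) ∧ Ln.length = nl d

/-- The logs that are read by the backtracking transitions: from every level one can get back to
the variable that is logged there. -/
inductive LG (w : Tm) : Path → List LP → Prop
  | nil : LG w [] []
  | flat (q : Path) (x : Sym) (L : List LP) : x.lev = 0 → LG w q L → LG w (q ++ [x]) L
  -- The left side of the application, evaluated on an empty tape, leads to the abstraction that
  -- logged this position; `L'` is the log there, so `Ln ++ L'` is the log to be restored at the
  -- variable.
  | arg (q b v : Path) (L L' Ln : List LP) (n : ℕ) : LG w q L →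
      PRun w n ⟨q ++ [.appL], L, [], .down⟩ ⟨b, L', [], .down⟩ →
      LP.IsLam w (.mk b v Ln) → LG w v (Ln ++ L') → LG w (q ++ [.appR]) (.mk b v Ln :: L)
  | sub (q d : Path) (L Ln : List LP) : kindAt w (q ++ .esL :: d) = some (.var (nb d)) →
      Ln.length = nl d → LG w (q ++ .esL :: d) (Ln ++ L) →
      LG w q L → LG w (q ++ [.esR]) (.mk q (q ++ .esL :: d) Ln :: L)

theorem LG.length {w : Tm} {q : Path} {L : List LP} (h : LG w q L) : L.length = nl q := by
  induction h <;> simp_all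

theorem LG.parent {w : Tm} {q : Path} {x : Sym} {L : List LP} (h : LG w (q ++ [x]) L) :
    ∃ L1 L2, L = L1 ++ L2 ∧ L1.length = x.lev ∧ LG w q L2 := by
  generalize hq : q ++ [x] = q' at h
  cases h with
  | nil => simp at hq
  | flat q' x L h1 h2 =>
    simp only [List.append_singleton_inj] at hq
    obtain ⟨rfl, rfl⟩ := hq
    exact ⟨[], L, rfl, by simp [h1], h2⟩
  | arg q' b v L L' Ln n h1 h2 h3 h4 =>
    simp only [List.append_singleton_inj] at hq
    obtain ⟨rfl, rfl⟩ := hq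
    exact ⟨[_], L, rfl, rfl, h1⟩
  | sub q' d L Ln h1 h2 h3 h4 =>
    simp only [List.append_singleton_inj] at hq
    obtain ⟨rfl, rfl⟩ := hq
    exact ⟨[_], L, rfl, rfl, h4⟩

/-- Climbing removes one entry of the log for each level that is left. -/
theorem LG.ancestor {w : Tm} {q p : Path} {Ln L : List LP} (h : LG w (q ++ p) (Ln ++ L))
    (hl : Ln.length = nl p) : LG w q L := by
  induction p using List.reverseRecOn generalizing Ln with
  | nil =>
    cases Ln <;> simp_all
  | append_singleton p x ih =>
    rw [← List.append_assoc] at h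
    obtain ⟨L1, L2, h1, h2, h3⟩ := h.parent
    simp only [nl_append, nl_cons, nl_nil, add_zero] at hl
    have h4 : Ln = Ln.take x.lev ++ Ln.drop x.lev := (List.take_append_drop _ _).symm
    rw [h4, List.append_assoc] at h1
    have h5 := List.append_inj h1 (by rw [List.length_take]; omega)
    rw [← h5.2] at h3
    exact ih h3 (by rw [List.length_drop]; omega)

theorem LG.parent_flat {w : Tm} {q : Path} {x : Sym} {L : List LP} (h : LG w (q ++ [x]) L)
    (hx : x.lev = 0) : LG w q L :=
  LG.ancestor (Ln := []) h (by simp [hx])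

/-- The direction in which a logged position below the tape `T` is sought. -/
def tdir : List PTape → Dir
  | [] => .down
  | .p :: T => tdir T
  -- Among the rules of `PFwd`, exactly `var` and `arg` change the direction, and exactly these
  -- change the number of logged positions on the tape. The parity of this number therefore tells in
  -- which direction a search has to run.
  | .pos _ :: T => (tdir T).flip

/-- The machine finds the binder of the logged position `l` from the address `q` with log `L`,
when `T` is on the tape above `l`. -/
def TE (w : Tm) (l : LP) (q : Path) (L : List LP) (T : List PTape) : Prop :=
  ∃ b v Ln n L', l = .mk b v Ln ∧ PRun w n ⟨q, L, T, tdir T⟩ ⟨b, L', [], .down⟩ ∧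
    LP.IsLam w l ∧ LG w v (Ln ++ L')

/-- A step into the state lengthens the search run by one. A step out of it is, by determinism, the
first step of the search, because the search ends in a stuck state. -/
theorem TE.of_step {w : Tm} {l : LP} {q q' : Path} {L L' : List LP} {T T' : List PTape}
    (h : TE w l q L T) (hs : PStep w ⟨q', L', T', tdir T'⟩ ⟨q, L, T, tdir T⟩ ∨
      PStep w ⟨q, L, T, tdir T⟩ ⟨q', L', T', tdir T'⟩) : TE w l q' L' T' := by
  obtain ⟨b, v, Ln, n, L1, rfl, h1, h2, h3⟩ := h
  rcases hs with hs | hs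
  · exact ⟨b, v, Ln, n + 1, L1, rfl, .head hs h1, h2, h3⟩
  · obtain ⟨d, rfl, hk, hl⟩ := h2
    obtain ⟨m, hm⟩ := h1.tail_of_final (not_step_of_lam (kindAt_parent hk)) hs
    exact ⟨b, _, Ln, m, L1, rfl, hm, ⟨d, rfl, hk, hl⟩, h3⟩

/-- The invariant of the runs from the initial states: backtracking does not fail. -/
def Good (w : Tm) (s : PState) : Prop :=
  LG w s.path s.log ∧ ∀ T l T', s.tape = T ++ .pos l :: T' → TE w l s.path s.log T

/-- A search that is at an abstraction with an empty tape is over, so this abstraction is the binder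
that was logged. -/
theorem TE.nil_inv {w : Tm} {l : LP} {q : Path} {L : List LP} (h : TE w l q L [])
    (hq : kindAt w q = some .lam) :
    ∃ v Ln, l = .mk q v Ln ∧ LP.IsLam w l ∧ LG w v (Ln ++ L) := by
  obtain ⟨b, v, Ln, n, L1, rfl, h1, h2, h3⟩ := h
  cases h1 with
  | refl => exact ⟨v, Ln, rfl, h2, h3⟩
  | head h4 => exact (not_step_of_lam hq _ h4).elim

theorem LG.arg_inv {w : Tm} {q : Path} {l : LP} {L : List LP}
    (h : LG w (q ++ [.appR]) (l :: L)) : TE w l (q ++ [.appL]) L [] := by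
  generalize hq : q ++ [.appR] = q' at h
  generalize hL : l :: L = L0 at h
  cases h with
  | nil => simp at hq
  | flat q' x L h1 h2 =>
    simp only [List.append_singleton_inj] at hq
    obtain ⟨rfl, rfl⟩ := hq
    simp at h1
  | arg q' b v L L' Ln n h1 h2 h3 h4 =>
    simp only [List.append_singleton_inj, and_true] at hq
    simp only [List.cons.injEq] at hL
    obtain ⟨rfl, rfl⟩ := hL
    subst hq
    exact ⟨b, v, Ln, n, L', rfl, h2, h3, h4⟩
  | sub q' d L Ln h1 h2 h3 h4 =>
    simp at hq

theorem LG.sub_inv {w : Tm} {q : Path} {l : LP} {L : List LP}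
    (h : LG w (q ++ [.esR]) (l :: L)) :
    ∃ d Ln, l = .mk q (q ++ .esL :: d) Ln ∧ kindAt w (q ++ .esL :: d) = some (.var (nb d)) ∧
      Ln.length = nl d ∧ LG w (q ++ .esL :: d) (Ln ++ L) := by
  generalize hq : q ++ [.esR] = q' at h
  generalize hL : l :: L = L0 at h
  cases h with
  | nil => simp at hq
  | flat q' x L h1 h2 =>
    simp only [List.append_singleton_inj] at hq
    obtain ⟨rfl, rfl⟩ := hq
    simp at h1
  | arg q' b v L L' Ln n h1 h2 h3 h4 =>
    simp at hq
  | sub q' d L Ln h1 h2 h3 h4 =>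
    simp only [List.append_singleton_inj, and_true] at hq
    simp only [List.cons.injEq] at hL
    obtain ⟨rfl, rfl⟩ := hL
    subst hq
    exact ⟨d, Ln, rfl, h1, h2, h3⟩

/-- The transitions for every direction of the state. -/
theorem PFwd.link {w : Tm} {q q' : Path} {L L' : List LP} {T T' : List PTape} {d d' e e' : Dir}
    (h : PFwd w ⟨q, L, T, d⟩ ⟨q', L', T', d'⟩) (he : (e = d ∧ e' = d') ∨ (e = d.flip ∧ e' = d'.flip)) :
    PStep w ⟨q, L, T, e⟩ ⟨q', L', T', e'⟩ ∨ PStep w ⟨q', L', T', e'⟩ ⟨q, L, T, e⟩ := by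
  rcases he with ⟨rfl, rfl⟩ | ⟨rfl, rfl⟩
  · exact .inl (.inl h)
  · exact .inr (.inr (by simpa using h))

theorem Dir.eq_or_flip (e d : Dir) : e = d ∨ e = d.flip := by
  cases e <;> cases d <;> simp

/-- A transition does not look below the tape elements it touches. Hence the search for a logged
position further down makes the same transition, or its reversal, and `TE.of_step` applies. The
element touched is treated apart: `var` creates a logged position whose search is empty, and `arg`
turns the search attached to the tape into the one required by `LG.arg`. The equivalence, rather
than one implication, covers the reversed rules. -/
theorem Good.fwd {w : Tm} {s s' : PState} (h : PFwd w s s') : Good w s ↔ Good w s' := by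
  cases h with
  | app q L T hk =>
    have key (T1) := (PFwd.app q L T1 hk).link (e := tdir T1) (e' := tdir (.p :: T1))
      (Dir.eq_or_flip (tdir T1) .down |>.imp (by simp [tdir]) (by simp [tdir]))
    constructor
    · rintro ⟨h1, h2⟩
      refine ⟨.flat _ _ _ rfl h1, fun T1 l T2 hT => ?_⟩
      cases T1 with
      | nil => simp at hT
      | cons x T1 =>
        simp only [List.cons_append, List.cons.injEq] at hT
        obtain ⟨rfl, hT⟩ := hT
        exact (h2 T1 l T2 hT).of_step (key T1).symm
    · rintro ⟨h1, h2⟩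
      refine ⟨h1.parent_flat rfl, fun T1 l T2 hT => ?_⟩
      exact (h2 (.p :: T1) l T2 (by simpa using hT)).of_step (key T1)
  | lam q L T hk =>
    have key (T1) := (PFwd.lam q L T1 hk).link (e := tdir (.p :: T1)) (e' := tdir T1)
      (Dir.eq_or_flip (tdir T1) .down |>.imp (by simp [tdir]) (by simp [tdir]))
    constructor
    · rintro ⟨h1, h2⟩
      refine ⟨.flat _ _ _ rfl h1, fun T1 l T2 hT => ?_⟩
      exact (h2 (.p :: T1) l T2 (by simpa using hT)).of_step (key T1).symm
    · rintro ⟨h1, h2⟩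
      refine ⟨h1.parent_flat rfl, fun T1 l T2 hT => ?_⟩
      cases T1 with
      | nil => simp at hT
      | cons x T1 =>
        simp only [List.cons_append, List.cons.injEq] at hT
        obtain ⟨rfl, hT⟩ := hT
        exact (h2 T1 l T2 hT).of_step (key T1)
  | es q L T hk =>
    have key (T1) := (PFwd.es q L T1 hk).link (e := tdir T1) (e' := tdir T1)
      (Dir.eq_or_flip (tdir T1) .down |>.imp (by simp) (by simp))
    constructor
    · rintro ⟨h1, h2⟩
      exact ⟨.flat _ _ _ rfl h1, fun T1 l T2 hT => (h2 T1 l T2 hT).of_step (key T1).symm⟩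
    · rintro ⟨h1, h2⟩
      exact ⟨h1.parent_flat rfl, fun T1 l T2 hT => (h2 T1 l T2 hT).of_step (key T1)⟩
  | var b d Ln L T hk hl =>
    have hlam := kindAt_parent hk
    have hI : LP.IsLam w (.mk b (b ++ .lam :: d) Ln) := ⟨d, rfl, hk, hl⟩
    have key (T1) := (PFwd.var b d Ln L T1 hk hl).link (e := tdir T1)
      (e' := tdir (.pos (.mk b (b ++ .lam :: d) Ln) :: T1))
      (Dir.eq_or_flip (tdir T1) .down |>.imp
        (fun h => by simp [tdir, h]) (fun h => by simp [tdir, h]))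
    constructor
    · rintro ⟨h1, h2⟩
      refine ⟨LG.ancestor h1 (by simp [hl]), fun T1 l T2 hT => ?_⟩
      cases T1 with
      | nil =>
        simp only [List.nil_append, List.cons.injEq, PTape.pos.injEq] at hT
        obtain ⟨rfl, -⟩ := hT
        exact ⟨b, _, Ln, 0, L, rfl, .refl _, hI, h1⟩
      | cons x T1 =>
        simp only [List.cons_append, List.cons.injEq] at hT
        obtain ⟨rfl, hT⟩ := hT
        exact (h2 T1 l T2 hT).of_step (key T1).symm
    · rintro ⟨h1, h2⟩
      refine ⟨?_, fun T1 l T2 hT => ?_⟩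
      · obtain ⟨v, Ln', h3, h4, h5⟩ := (h2 [] _ T rfl).nil_inv hlam
        cases h3
        exact h5
      · exact (h2 (_ :: T1) l T2 (by simpa using hT)).of_step (key T1)
  | sub b d Ln L T hk hl =>
    have key (T1) := (PFwd.sub b d Ln L T1 hk hl).link (e := tdir T1) (e' := tdir T1)
      (Dir.eq_or_flip (tdir T1) .down |>.imp (by simp) (by simp))
    constructor
    · rintro ⟨h1, h2⟩
      exact ⟨.sub _ _ _ _ hk hl h1 (LG.ancestor h1 (by simp [hl])),
        fun T1 l T2 hT => (h2 T1 l T2 hT).of_step (key T1).symm⟩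
    · rintro ⟨h1, h2⟩
      refine ⟨?_, fun T1 l T2 hT => (h2 T1 l T2 hT).of_step (key T1)⟩
      obtain ⟨d', Ln', h3, -, -, h4⟩ := h1.sub_inv
      simp only [LP.mk.injEq] at h3
      obtain ⟨-, h5, rfl⟩ := h3
      rw [← h5] at h4
      exact h4
  | arg q l L T hk =>
    have key (T1) := (PFwd.arg q l L T1 hk).link (e := tdir (.pos l :: T1)) (e' := tdir T1)
      (Dir.eq_or_flip (tdir T1) .down |>.imp
        (fun h => by simp [tdir, h]) (fun h => by simp [tdir, h]))
    constructor
    · rintro ⟨h1, h2⟩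
      refine ⟨?_, fun T1 l' T2 hT => ?_⟩
      · obtain ⟨b, v, Ln, n, L', rfl, h3, h4, h5⟩ := h2 [] l T rfl
        exact .arg _ _ _ _ _ _ _ (h1.parent_flat rfl) h3 h4 h5
      · exact (h2 (_ :: T1) l' T2 (by simpa using hT)).of_step (key T1).symm
    · rintro ⟨h1, h2⟩
      refine ⟨.flat _ _ _ rfl (LG.ancestor (Ln := [l]) h1 rfl), fun T1 l' T2 hT => ?_⟩
      cases T1 with
      | nil =>
        simp only [List.nil_append, List.cons.injEq, PTape.pos.injEq] at hT
        obtain ⟨rfl, -⟩ := hT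
        exact h1.arg_inv
      | cons x T1 =>
        simp only [List.cons_append, List.cons.injEq] at hT
        obtain ⟨rfl, hT⟩ := hT
        exact (h2 T1 l' T2 hT).of_step (key T1)

theorem Good.flip {w : Tm} {s : PState} : Good w s.flip ↔ Good w s := Iff.rfl

theorem Good.step {w : Tm} {s s' : PState} (h : PStep w s s') (hs : Good w s) : Good w s' := by
  rcases h with h | h
  · exact (Good.fwd h).1 hs
  · exact Good.flip.1 ((Good.fwd h).2 (Good.flip.2 hs))

theorem Good.init (w : Tm) (k : ℕ) : Good w ⟨[], [], List.replicate k .p, .down⟩ := by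
  refine ⟨.nil, fun T l T' hT => ?_⟩
  have : PTape.pos l ∈ List.replicate k PTape.p := by
    change List.replicate k PTape.p = _ at hT
    rw [hT]; simp
  simp [List.mem_replicate] at this


/-! ### Comparison with the machine of the statement -/

/-- The address of the hole of a context. -/
def Ctx.path : Ctx → Path
  | .hole => []
  | .lam C => .lam :: C.path
  | .appL C _ => .appL :: C.path
  | .appR _ C => .appR :: C.path
  | .esL C _ => .esL :: C.path
  | .esR _ C => .esR :: C.path

@[simp] theorem Ctx.path_comp (C D : Ctx) : (C.comp D).path = C.path ++ D.path := by
  induction C <;> simp_all [comp, path]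

@[simp] theorem Ctx.plug_comp (C D : Ctx) (t : Tm) : (C.comp D).plug t = C.plug (D.plug t) := by
  induction C <;> simp_all [comp, plug]

@[simp] theorem Ctx.nb_path (C : Ctx) : nb C.path = C.binders := by
  induction C <;> simp_all [binders, path, add_comm]

@[simp] theorem Ctx.nl_path (C : Ctx) : nl C.path = C.level := by
  induction C <;> simp_all [level, path, add_comm]

theorem Ctx.plug_inj {C C' : Ctx} {t t' : Tm} (h : C.plug t = C'.plug t')
    (hp : C.path = C'.path) : C = C' ∧ t = t' := by
  induction C generalizing C' with
  | hole => cases C' <;> simp_all [plug, path]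
  | lam C ih | appL C _ ih | esL C _ ih | appR _ C ih | esR _ C ih =>
    cases C' <;> simp only [path, List.cons.injEq, reduceCtorEq, false_and, true_and] at hp
    simp only [plug, Tm.lam.injEq, Tm.app.injEq, Tm.es.injEq] at h
    first
      | obtain ⟨rfl, rfl⟩ := ih h hp
        exact ⟨rfl, rfl⟩
      | obtain ⟨rfl, rfl⟩ := ih h.1 hp
        exact ⟨by rw [h.2], rfl⟩
      | obtain ⟨rfl, rfl⟩ := ih h.2 hp
        exact ⟨by rw [h.1], rfl⟩

theorem Ctx.path_split {C : Ctx} {p q : Path} (h : C.path = p ++ q) :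
    ∃ D E : Ctx, C = D.comp E ∧ D.path = p ∧ E.path = q := by
  induction p generalizing C with
  | nil => exact ⟨.hole, C, rfl, rfl, h⟩
  | cons x p ih =>
    cases C <;> simp only [path, List.cons_append, List.cons.injEq, reduceCtorEq] at h
    all_goals
      obtain ⟨rfl, h⟩ := h
      obtain ⟨D, E, rfl, rfl, rfl⟩ := ih h
    · exact ⟨.lam D, E, rfl, rfl, rfl⟩
    · exact ⟨.appL D _, E, rfl, rfl, rfl⟩
    · exact ⟨.appR _ D, E, rfl, rfl, rfl⟩
    · exact ⟨.esL D _, E, rfl, rfl, rfl⟩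
    · exact ⟨.esR _ D, E, rfl, rfl, rfl⟩

theorem kindAt_plug_append (C : Ctx) (t : Tm) (p : Path) :
    kindAt (C.plug t) (C.path ++ p) = kindAt t p := by
  induction C <;> simp_all [Ctx.plug, Ctx.path, kindAt]

theorem kindAt_plug (C : Ctx) (t : Tm) : kindAt (C.plug t) C.path = kindAt t [] := by
  simpa using kindAt_plug_append C t []

theorem kindAt_nil_var {t : Tm} {i : ℕ} (h : kindAt t [] = some (.var i)) : t = .var i := by
  cases t <;> simp_all [kindAt]

theorem kindAt_nil_app {t : Tm} (h : kindAt t [] = some .app) : ∃ a b, t = .app a b := by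
  cases t <;> simp_all [kindAt]

theorem kindAt_nil_lam {t : Tm} (h : kindAt t [] = some .lam) : ∃ a, t = .lam a := by
  cases t <;> simp_all [kindAt]

theorem kindAt_nil_es {t : Tm} (h : kindAt t [] = some .es) : ∃ a b, t = .es a b := by
  cases t <;> simp_all [kindAt]

/-- A logged position with absolute addresses in `w` represents a logged position. -/
inductive ConcL (w : Tm) : LP → LPos → Prop
  | lam (C D : Ctx) (Ln : List LP) (Ln' : List LPos) :
      C.plug (.lam (D.plug (.var D.binders))) = w → List.Forall₂ (ConcL w) Ln Ln' →
      ConcL w (.mk C.path (C.path ++ .lam :: D.path) Ln) (.mk (.var D.binders) (.lam D) Ln')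
  | es (C D : Ctx) (u : Tm) (Ln : List LP) (Ln' : List LPos) :
      C.plug (.es (D.plug (.var D.binders)) u) = w → List.Forall₂ (ConcL w) Ln Ln' →
      ConcL w (.mk C.path (C.path ++ .esL :: D.path) Ln) (.mk (.var D.binders) (.esL D u) Ln')

/-- An element of the tape with absolute addresses in `w` represents an element of the tape. -/
inductive ConcT (w : Tm) : PTape → TapeElem → Prop
  | p : ConcT w .p .p
  | pos (l : LP) (l' : LPos) : ConcL w l l' → ConcT w (.pos l) (.pos l')

/-- A state with absolute addresses in `w` represents a state. -/
structure Conc (w : Tm) (s : PState) (c : State) : Prop where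
  path : c.ctx.path = s.path
  plug : c.ctx.plug c.code = w
  log : List.Forall₂ (ConcL w) s.log c.log
  tape : List.Forall₂ (ConcT w) s.tape c.tape
  dir : c.dir = s.dir

theorem ConcL.lam_inv {w : Tm} {b d : Path} {Ln : List LP} {l : LPos}
    (h : ConcL w (.mk b (b ++ .lam :: d) Ln) l) :
    ∃ C D Ln', l = .mk (.var (Ctx.binders D)) (.lam D) Ln' ∧ Ctx.path C = b ∧ D.path = d ∧
      C.plug (.lam (D.plug (.var D.binders))) = w ∧ List.Forall₂ (ConcL w) Ln Ln' := by
  generalize hv : b ++ .lam :: d = v at h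
  cases h with
  | lam C D _ Ln' h1 h2 =>
    simp at hv
    exact ⟨C, D, Ln', rfl, rfl, hv.symm, h1, h2⟩
  | es => simp at hv

theorem ConcL.es_inv {w : Tm} {b d : Path} {Ln : List LP} {l : LPos}
    (h : ConcL w (.mk b (b ++ .esL :: d) Ln) l) :
    ∃ C D u Ln', l = .mk (.var (Ctx.binders D)) (.esL D u) Ln' ∧ Ctx.path C = b ∧ D.path = d ∧
      C.plug (.es (D.plug (.var D.binders)) u) = w ∧ List.Forall₂ (ConcL w) Ln Ln' := by
  generalize hv : b ++ .esL :: d = v at h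
  cases h with
  | es C D u _ Ln' h1 h2 =>
    simp at hv
    exact ⟨C, D, u, Ln', rfl, rfl, hv.symm, h1, h2⟩
  | lam => simp at hv

theorem forall₂_append_left {α β : Type*} {R : α → β → Prop} {l₁ l₂ : List α} {l : List β}
    (h : List.Forall₂ R (l₁ ++ l₂) l) :
    ∃ m₁ m₂, l = m₁ ++ m₂ ∧ List.Forall₂ R l₁ m₁ ∧ List.Forall₂ R l₂ m₂ := by
  induction l₁ generalizing l with
  | nil => exact ⟨[], l, rfl, .nil, h⟩
  | cons a l₁ ih =>
    cases h with
    | cons h1 h2 =>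
      obtain ⟨m₁, m₂, rfl, h3, h4⟩ := ih h2
      exact ⟨_ :: m₁, m₂, rfl, .cons h1 h3, h4⟩

theorem forall₂_append_right {α β : Type*} {R : α → β → Prop} {l : List α} {m₁ m₂ : List β}
    (h : List.Forall₂ R l (m₁ ++ m₂)) :
    ∃ l₁ l₂, l = l₁ ++ l₂ ∧ List.Forall₂ R l₁ m₁ ∧ List.Forall₂ R l₂ m₂ := by
  obtain ⟨l₁, l₂, h1, h2, h3⟩ := forall₂_append_left h.flip
  exact ⟨l₁, l₂, h1, h2.flip, h3.flip⟩

theorem forall₂_append {α β : Type*} {R : α → β → Prop} {l₁ l₂ : List α} {m₁ m₂ : List β}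
    (h : List.Forall₂ R l₁ m₁) (h' : List.Forall₂ R l₂ m₂) :
    List.Forall₂ R (l₁ ++ l₂) (m₁ ++ m₂) := by
  induction h with
  | nil => exact h'
  | cons h1 _ ih => exact .cons h1 ih

theorem Ctx.path_snoc {C : Ctx} {q : Path} {x : Sym} (h : C.path = q ++ [x]) :
    ∃ D E : Ctx, C = D.comp E ∧ D.path = q ∧
      ((x = .lam ∧ E = .lam .hole) ∨ (∃ t, x = .appL ∧ E = .appL .hole t) ∨
        (∃ t, x = .appR ∧ E = .appR t .hole) ∨ (∃ t, x = .esL ∧ E = .esL .hole t) ∨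
        (∃ t, x = .esR ∧ E = .esR t .hole)) := by
  obtain ⟨D, E, rfl, h1, h2⟩ := path_split h
  refine ⟨D, E, rfl, h1, ?_⟩
  cases E <;> simp only [path, List.cons.injEq, reduceCtorEq] at h2
  all_goals
    obtain ⟨rfl, h2⟩ := h2
    rename Ctx => E
    cases E <;> simp_all [path]

theorem Conc.fwd {w : Tm} {s s' : PState} {c : State} (h : PFwd w s s') (hc : Conc w s c) :
    ∃ c', Step c c' ∧ Conc w s' c' := by
  obtain ⟨t, C, L', T', e⟩ := c
  obtain ⟨hp, hw, hL, hT, he⟩ := hc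
  cases h with
  | app q L T hk =>
    dsimp only at *
    subst hp hw he
    rw [kindAt_plug] at hk
    obtain ⟨a, b, rfl⟩ := kindAt_nil_app hk
    exact ⟨_, .dot1 _ _ _ _ _, by simp [Ctx.path], by simp [Ctx.plug], hL, .cons .p hT, rfl⟩
  | lam q L T hk =>
    dsimp only at *
    subst hp hw he
    rw [kindAt_plug] at hk
    obtain ⟨a, rfl⟩ := kindAt_nil_lam hk
    cases hT with
    | cons h1 h2 =>
      cases h1
      exact ⟨_, .dot2 _ _ _ _, by simp [Ctx.path], by simp [Ctx.plug], hL, h2, rfl⟩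
  | es q L T hk =>
    dsimp only at *
    subst hp hw he
    rw [kindAt_plug] at hk
    obtain ⟨a, b, rfl⟩ := kindAt_nil_es hk
    exact ⟨_, .es _ _ _ _ _, by simp [Ctx.path], by simp [Ctx.plug], hL, hT, rfl⟩
  | var b d Ln L T hk hl =>
    dsimp only at *
    subst hw he
    rw [← hp, kindAt_plug] at hk
    obtain ⟨D, E, rfl, rfl, hE⟩ := Ctx.path_split hp
    cases E <;> simp only [Ctx.path, List.cons.injEq, reduceCtorEq, false_and, true_and] at hE
    subst hE
    obtain ⟨M1, M2, rfl, h1, h2⟩ := forall₂_append_left hL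
    rw [Ctx.nb_path] at hk
    rw [Ctx.nl_path] at hl
    obtain rfl := kindAt_nil_var hk
    exact ⟨_, .var _ _ _ _ _ (by rw [← h1.length_eq, hl]), rfl, by simp [Ctx.plug], h2,
      .cons (.pos _ _ (.lam _ _ _ _ (by simp [Ctx.plug]) h1)) hT, rfl⟩
  | sub b d Ln L T hk hl =>
    dsimp only at *
    subst hw he
    rw [← hp, kindAt_plug] at hk
    obtain ⟨D, E, rfl, rfl, hE⟩ := Ctx.path_split hp
    cases E <;> simp only [Ctx.path, List.cons.injEq, reduceCtorEq, false_and, true_and] at hE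
    subst hE
    obtain ⟨M1, M2, rfl, h1, h2⟩ := forall₂_append_left hL
    rw [Ctx.nb_path] at hk
    rw [Ctx.nl_path] at hl
    obtain rfl := kindAt_nil_var hk
    exact ⟨_, .var2 _ _ _ _ _ _ (by rw [← h1.length_eq, hl]), by simp [Ctx.path],
      by simp [Ctx.plug], .cons (.es _ _ _ _ _ (by simp [Ctx.plug]) h1) h2, hT, rfl⟩
  | arg q l L T hk =>
    dsimp only at *
    subst hw he
    obtain ⟨D, E, rfl, rfl, hE⟩ := Ctx.path_snoc hp
    simp only [reduceCtorEq, false_and, exists_false, or_false, false_or, true_and] at hE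
    obtain ⟨u, rfl⟩ := hE
    cases hT with
    | cons h1 h2 =>
      cases h1 with
      | pos l l' h1 =>
        exact ⟨_, .arg _ _ _ _ _ _, by simp [Ctx.path], by simp [Ctx.plug], .cons h1 hL, h2, rfl⟩

/-- Reversed transitions are obtained from this and `flip`, which makes `Conc.step` a statement
about all the rules. No invariant is needed here, as absolute addresses carry more information than
contexts. -/
theorem Conc.bwd {w : Tm} {s s' : PState} {c' : State} (h : PFwd w s s') (hc : Conc w s' c') :
    ∃ c, Step c c' ∧ Conc w s c := by
  obtain ⟨t, C, L', T', e⟩ := c'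
  obtain ⟨hp, hw, hL, hT, he⟩ := hc
  cases h with
  | app q L T hk =>
    dsimp only at *
    subst hw he
    obtain ⟨D, E, rfl, rfl, hE⟩ := Ctx.path_snoc hp
    simp only [reduceCtorEq, false_and, exists_false, or_false, false_or, true_and] at hE
    obtain ⟨u, rfl⟩ := hE
    cases hT with
    | cons h1 h2 =>
      cases h1
      exact ⟨_, .dot1 _ _ _ _ _, rfl, by simp [Ctx.plug], hL, h2, rfl⟩
  | lam q L T hk =>
    dsimp only at *
    subst hw he
    obtain ⟨D, E, rfl, rfl, hE⟩ := Ctx.path_snoc hp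
    simp only [reduceCtorEq, false_and, exists_false, or_false, true_and] at hE
    subst hE
    exact ⟨_, .dot2 _ _ _ _, rfl, by simp [Ctx.plug], hL, .cons .p hT, rfl⟩
  | es q L T hk =>
    dsimp only at *
    subst hw he
    obtain ⟨D, E, rfl, rfl, hE⟩ := Ctx.path_snoc hp
    simp only [reduceCtorEq, false_and, exists_false, or_false, false_or, true_and] at hE
    obtain ⟨u, rfl⟩ := hE
    exact ⟨_, .es _ _ _ _ _, rfl, by simp [Ctx.plug], hL, hT, rfl⟩
  | var b d Ln L T hk hl =>
    dsimp only at *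
    subst he
    cases hT with
    | cons h1 h2 =>
      cases h1 with
      | pos l l' h1 =>
        obtain ⟨C', D, Ln', rfl, rfl, rfl, h3, h4⟩ := h1.lam_inv
        obtain ⟨rfl, rfl⟩ := Ctx.plug_inj (hw.trans h3.symm) hp
        refine ⟨_, .var _ _ _ _ _ (by rw [← h4.length_eq, hl, Ctx.nl_path]), by simp [Ctx.path],
          by simpa [Ctx.plug] using h3, forall₂_append h4 hL, h2, rfl⟩
  | sub b d Ln L T hk hl =>
    dsimp only at *
    subst he
    obtain ⟨B, E, rfl, rfl, hE⟩ := Ctx.path_snoc hp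
    simp only [reduceCtorEq, false_and, exists_false, false_or, true_and] at hE
    obtain ⟨u, rfl⟩ := hE
    cases hL with
    | cons h1 h2 =>
      obtain ⟨C', D, u', Ln', rfl, h5, rfl, h3, h4⟩ := h1.es_inv
      rw [Ctx.plug_comp, ← h3] at hw
      obtain ⟨rfl, h6⟩ := Ctx.plug_inj hw h5.symm
      simp only [Ctx.plug, Tm.es.injEq] at h6
      obtain ⟨rfl, rfl⟩ := h6
      refine ⟨_, .var2 _ _ _ _ _ _ (by rw [← h4.length_eq, hl, Ctx.nl_path]), by simp [Ctx.path],
        by simpa [Ctx.plug] using h3, forall₂_append h4 h2, hT, rfl⟩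
  | arg q l L T hk =>
    dsimp only at *
    subst hw he
    obtain ⟨D, E, rfl, rfl, hE⟩ := Ctx.path_snoc hp
    simp only [reduceCtorEq, false_and, exists_false, or_false, false_or, true_and] at hE
    obtain ⟨u, rfl⟩ := hE
    cases hL with
    | cons h1 h2 =>
      exact ⟨_, .arg _ _ _ _ _ _, by simp [Ctx.path], by simp [Ctx.plug], h2,
        .cons (.pos _ _ h1) hT, rfl⟩

/-- Reversal of a state. -/
def State.flip (c : State) : State := ⟨c.code, c.ctx, c.log, c.tape, c.dir.flip⟩

@[simp] theorem State.flip_flip (c : State) : c.flip.flip = c := by simp [flip]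

theorem Step.flip {c c' : State} (h : Step c c') : Step c'.flip c.flip := by
  cases h with
  | dot1 => exact .dot3 ..
  | dot2 => exact .dot4 ..
  | var _ _ _ _ _ h => exact .bt2 _ _ _ _ _ h
  | bt2 _ _ _ _ _ h => exact .var _ _ _ _ _ h
  | dot3 => exact .dot1 ..
  | dot4 => exact .dot2 ..
  | arg => exact .bt1 ..
  | bt1 => exact .arg ..
  | es => exact .es2 ..
  | var2 _ _ _ _ _ _ h => exact .var3 _ _ _ _ _ _ h
  | es2 => exact .es ..
  | var3 _ _ _ _ _ _ h => exact .var2 _ _ _ _ _ _ h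

theorem Conc.flip {w : Tm} {s : PState} {c : State} (h : Conc w s c) : Conc w s.flip c.flip :=
  ⟨h.path, h.plug, h.log, h.tape, congrArg Dir.flip h.dir⟩

theorem Conc.step {w : Tm} {s s' : PState} {c : State} (h : PStep w s s') (hc : Conc w s c) :
    ∃ c', Step c c' ∧ Conc w s' c' := by
  rcases h with h | h
  · exact hc.fwd h
  · obtain ⟨c', h1, h2⟩ := hc.flip.bwd h
    exact ⟨c'.flip, by simpa using h1.flip, by simpa using h2.flip⟩

/-- Only `bt2` and `var3` need the invariant: they compare contexts relative to a binder, and `Good`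
supplies that the absolute binder in the logged position is the one at hand. -/
theorem Conc.step_inv {w : Tm} {s : PState} {c c' : State} (hc : Conc w s c) (hg : Good w s)
    (h : Step c c') : ∃ s', PStep w s s' ∧ Conc w s' c' := by
  obtain ⟨q, L', T', e⟩ := s
  obtain ⟨hp, hw, hL, hT, he⟩ := hc
  cases h with
  | dot1 t u C L T =>
    dsimp only at *
    subst hp hw he
    exact ⟨_, .inl (.app _ _ _ (by rw [kindAt_plug]; rfl)), by simp [Ctx.path],
      by simp [Ctx.plug], hL, .cons .p hT, rfl⟩
  | dot2 t C L T =>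
    dsimp only at *
    subst hp hw he
    cases hT with
    | cons h1 h2 =>
      cases h1
      exact ⟨_, .inl (.lam _ _ _ (by rw [kindAt_plug]; rfl)), by simp [Ctx.path],
        by simp [Ctx.plug], hL, h2, rfl⟩
  | var C D Ln L T hl =>
    dsimp only at *
    subst hp hw he
    obtain ⟨M1, M2, rfl, h1, h2⟩ := forall₂_append_right hL
    have hk : kindAt ((C.comp (.lam D)).plug (.var D.binders)) (C.path ++ .lam :: D.path) =
        some (.var (nb D.path)) := by
      have := kindAt_plug (C.comp (.lam D)) (.var D.binders)
      rw [Ctx.path_comp] at this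
      rw [Ctx.nb_path]
      exact this
    rw [Ctx.path_comp]
    exact ⟨_, .inl (.var _ _ _ _ _ hk (by rw [h1.length_eq, hl, Ctx.nl_path])), rfl,
      by simp [Ctx.plug], h2, .cons (.pos _ _ (.lam _ _ _ _ (by simp [Ctx.plug]) h1)) hT, rfl⟩
  | bt2 C D Ln L T hl =>
    dsimp only at *
    subst hp hw he
    cases hT with
    | cons h1 h2 =>
      cases h1 with
      | pos l l' h1 =>
        -- The logged position is on top of the tape, so its search starts with an empty tape at the
        -- current abstraction.
        have hte : TE _ l C.path L' [] := hg.2 [] l _ rfl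
        obtain ⟨v, Ln1, rfl, ⟨d, rfl, hk, hl1⟩, -⟩ :=
          hte.nil_inv (by rw [kindAt_plug]; rfl)
        obtain ⟨C', D', Ln', h5, h6, rfl, h3, h4⟩ := h1.lam_inv
        simp only [LPos.mk.injEq, Ctx.lam.injEq] at h5
        obtain ⟨-, rfl, rfl⟩ := h5
        have := PFwd.var _ _ _ L' (by assumption) hk hl1
        exact ⟨⟨_, _, _, .up⟩, .inr this, by simp [Ctx.path], by simp [Ctx.plug],
          forall₂_append h4 hL, h2, rfl⟩
  | dot3 t u C L T =>
    dsimp only at *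
    subst hp hw he
    cases hT with
    | cons h1 h2 =>
      cases h1
      have hk : kindAt ((C.comp (.appL .hole u)).plug t) C.path = some .app := by
        rw [Ctx.plug_comp, kindAt_plug]; rfl
      have := PFwd.app _ L' (by assumption) hk
      exact ⟨⟨_, _, _, .up⟩, .inr (by simpa [Ctx.path] using this), rfl, by simp [Ctx.plug],
        hL, h2, rfl⟩
  | dot4 t C L T =>
    dsimp only at *
    subst hp hw he
    have hk : kindAt ((C.comp (.lam .hole)).plug t) C.path = some .lam := by
      rw [Ctx.plug_comp, kindAt_plug]; rfl
    have := PFwd.lam _ L' T' hk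
    exact ⟨⟨_, _, _, .up⟩, .inr (by simpa [Ctx.path] using this), rfl, by simp [Ctx.plug],
      hL, .cons .p hT, rfl⟩
  | arg t u C l L T =>
    dsimp only at *
    subst hp hw he
    cases hT with
    | cons h1 h2 =>
      cases h1 with
      | pos l l' h1 =>
      have hk : kindAt ((C.comp (.appL .hole u)).plug t) C.path = some .app := by
        rw [Ctx.plug_comp, kindAt_plug]; rfl
      have := PFwd.arg _ l L' (by assumption) hk
      exact ⟨⟨_, _, _, .down⟩, .inl (by simpa [Ctx.path] using this), by simp [Ctx.path],
        by simp [Ctx.plug], .cons h1 hL, h2, rfl⟩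
  | bt1 t u C l L T =>
    dsimp only at *
    subst hp hw he
    cases hL with
    | @cons l' _ Lp _ h1 h2 =>
      have hk : kindAt ((C.comp (.appR t .hole)).plug u) C.path = some .app := by
        rw [Ctx.plug_comp, kindAt_plug]; rfl
      have := PFwd.arg _ l' Lp T' hk
      exact ⟨⟨_, _, _, .down⟩, .inr (by simpa [Ctx.path] using this), by simp [Ctx.path],
        by simp [Ctx.plug], h2, .cons (.pos _ _ h1) hT, rfl⟩
  | es t u C L T =>
    dsimp only at *
    subst hp hw he
    exact ⟨_, .inl (.es _ _ _ (by rw [kindAt_plug]; rfl)), by simp [Ctx.path],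
      by simp [Ctx.plug], hL, hT, rfl⟩
  | var2 u C D Ln L T hl =>
    dsimp only at *
    subst hp hw he
    obtain ⟨M1, M2, rfl, h1, h2⟩ := forall₂_append_right hL
    have hk : kindAt ((C.comp (.esL D u)).plug (.var D.binders)) (C.path ++ .esL :: D.path) =
        some (.var (nb D.path)) := by
      have := kindAt_plug (C.comp (.esL D u)) (.var D.binders)
      rw [Ctx.path_comp] at this
      rw [Ctx.nb_path]
      exact this
    rw [Ctx.path_comp]
    exact ⟨_, .inl (.sub _ _ _ _ _ hk (by rw [h1.length_eq, hl, Ctx.nl_path])),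
      by simp [Ctx.path], by simp [Ctx.plug],
      .cons (.es _ _ _ _ _ (by simp [Ctx.plug]) h1) h2, hT, rfl⟩
  | es2 t u C L T =>
    dsimp only at *
    subst hp hw he
    have hk : kindAt ((C.comp (.esL .hole u)).plug t) C.path = some .es := by
      rw [Ctx.plug_comp, kindAt_plug]; rfl
    have := PFwd.es _ L' T' hk
    exact ⟨⟨_, _, _, .up⟩, .inr (by simpa [Ctx.path] using this), rfl, by simp [Ctx.plug],
      hL, hT, rfl⟩
  | var3 u C D Ln L T hl =>
    dsimp only at *
    subst hp hw he
    cases hL with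
    | @cons _ _ Lp _ h1 h2 =>
      have hLG := hg.1
      simp only [Ctx.path_comp, Ctx.path] at hLG
      obtain ⟨d, Ln1, rfl, hk, hl1, -⟩ := hLG.sub_inv
      obtain ⟨C', D', u', Ln', h5, h6, rfl, h3, h4⟩ := h1.es_inv
      simp only [LPos.mk.injEq, Ctx.esL.injEq] at h5
      obtain ⟨-, ⟨rfl, rfl⟩, rfl⟩ := h5
      have := PFwd.sub _ _ _ Lp T' hk hl1
      exact ⟨⟨_, _, _, .up⟩, .inr (by simpa [Ctx.path] using this), by simp [Ctx.path],
        by simp [Ctx.plug], forall₂_append h4 h2, hT, rfl⟩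

theorem Conc.init (w : Tm) (k : ℕ) :
    Conc w ⟨[], [], List.replicate k .p, .down⟩ (init w k) := by
  refine ⟨rfl, rfl, .nil, ?_, rfl⟩
  change List.Forall₂ _ (List.replicate k PTape.p) (List.replicate k TapeElem.p)
  induction k with
  | zero => exact .nil
  | succ k ih => exact .cons .p ih

/-- The initial state with absolute addresses. -/
def pinit (k : ℕ) : PState := ⟨[], [], List.replicate k .p, .down⟩

theorem PRun.snoc {w : Tm} {n : ℕ} {s s' s'' : PState} (h : PRun w n s s')
    (h' : PStep w s' s'') : PRun w (n + 1) s s'' := h.trans h'.run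

/-- A run from the initial state is the image of a run on absolute addresses. -/
theorem Steps.to_pRun {w : Tm} {n k : ℕ} {c : State} (h : Steps n (LIAM.init w k) c) :
    ∃ s, PRun w n (pinit k) s ∧ Conc w s c ∧ Good w s := by
  generalize hi : LIAM.init w k = i at h
  induction h with
  | refl => subst hi; exact ⟨_, .refl _, Conc.init w k, Good.init w k⟩
  | tail n _ s' s'' _ h1 ih =>
    obtain ⟨s, h2, h3, h4⟩ := ih hi
    obtain ⟨r, h5, h6⟩ := h3.step_inv h4 h1
    exact ⟨r, h2.snoc h5, h6, h4.step h5⟩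

theorem Steps.head {n : ℕ} {s s' s'' : State} (h : Step s s') (h' : Steps n s' s'') :
    Steps (n + 1) s s'' := by
  induction h' with
  | refl => exact .tail _ _ _ _ (.refl _) h
  | tail n _ _ _ _ h2 ih => exact .tail _ _ _ _ (ih h) h2

theorem PRun.to_steps {w : Tm} {n : ℕ} {s s' : PState} {c : State} (h : PRun w n s s')
    (hc : Conc w s c) : ∃ c', Steps n c c' := by
  induction h generalizing c with
  | refl => exact ⟨c, .refl _⟩
  | head h1 _ ih =>
    obtain ⟨c1, h2, h3⟩ := hc.step h1
    obtain ⟨c2, h4⟩ := ih h3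
    exact ⟨c2, .head h2 h4⟩

/-- If `runLength t k` is a natural number, it bounds all runs of `t`, so each run of `u` is at
least one shorter, and so is their supremum. Finiteness is essential: the hypothesis on runs does
not exclude that both lengths are infinite. -/
theorem runLength_lt {t u : Tm} {k : ℕ}
    (h : ∀ n s, PRun u n (pinit k) s → ∃ m s', n < m ∧ PRun t m (pinit k) s')
    (ht : runLength t k ≠ ⊤) : runLength u k < runLength t k := by
  have key : ∀ n : ℕ, (∃ c, Steps n (init u k) c) → (n : ℕ∞) + 1 ≤ runLength t k := by
    rintro n ⟨c, hc⟩
    obtain ⟨s, hs, -⟩ := hc.to_pRun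
    obtain ⟨m, s', hm, hs'⟩ := h n s hs
    obtain ⟨c', hc'⟩ := hs'.to_steps (Conc.init t k)
    have h1 : (m : ℕ∞) ≤ runLength t k := le_iSup₂_of_le m ⟨c', hc'⟩ le_rfl
    exact le_trans (by exact_mod_cast hm) h1
  obtain ⟨N, hN⟩ := ENat.ne_top_iff_exists.1 ht
  rw [← hN] at key ⊢
  have h0 := key 0 ⟨_, .refl _⟩
  cases N with
  | zero => simp at h0
  | succ N =>
    have h2 : runLength u k ≤ N := iSup₂_le fun n hn => by
      have := key n hn
      norm_cast at this ⊢
      omega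
    exact lt_of_le_of_lt h2 (by exact_mod_cast Nat.lt_succ_self N)


/-! ### Simulation between terms that differ below one address -/

/-- Nonempty runs. -/
def Reach (w : Tm) (s s' : PState) : Prop := ∃ n, 1 ≤ n ∧ PRun w n s s'

theorem PFwd.reach {w : Tm} {s s' : PState} (h : PFwd w s s') : Reach w s s' :=
  ⟨1, le_rfl, h.run⟩

theorem Reach.trans {w : Tm} {s s' s'' : PState} (h : Reach w s s') (h' : Reach w s' s'') :
    Reach w s s'' := by
  obtain ⟨m, hm, h⟩ := h
  obtain ⟨n, hn, h'⟩ := h'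
  exact ⟨m + n, by omega, h.trans h'⟩

theorem Reach.flip {w : Tm} {s s' : PState} (h : Reach w s s') : Reach w s'.flip s.flip := by
  obtain ⟨m, hm, h⟩ := h
  exact ⟨m, hm, h.flip⟩

/-- A simulation of the machine on `u` by the machine on `w`, for terms that coincide outside the
address `z`, which is of level `0`. The address `z ++ p` of `u` corresponds to the address `f p` of
`w`, where the log is extended by `c` and the tape by `τ p`. -/
structure Local (u w : Tm) where
  z : Path
  f : Path → Path
  c : List LP
  τ : Path → List PTape
  nl_z : nl z = 0
  kind_out : ∀ q, ¬ z <+: q → kindAt w q = kindAt u q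
  -- On `u` nothing corresponds to this nonempty run when `z` is first reached: this makes the final
  -- inequality strict.
  enter : ∀ T, Reach w ⟨z, [], T, .down⟩ ⟨f [], c, τ [] ++ T, .down⟩
  app_in : ∀ p L T, kindAt u (z ++ p) = some .app →
    Reach w ⟨f p, L, τ p ++ T, .down⟩
      ⟨f (p ++ [.appL]), L, τ (p ++ [.appL]) ++ .p :: T, .down⟩
  lam_in : ∀ p L T, kindAt u (z ++ p) = some .lam →
    Reach w ⟨f p, L, τ p ++ .p :: T, .down⟩ ⟨f (p ++ [.lam]), L, τ (p ++ [.lam]) ++ T, .down⟩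
  es_in : ∀ p L T, kindAt u (z ++ p) = some .es →
    Reach w ⟨f p, L, τ p ++ T, .down⟩ ⟨f (p ++ [.esL]), L, τ (p ++ [.esL]) ++ T, .down⟩
  arg_in : ∀ p l L T, kindAt u (z ++ p) = some .app →
    Reach w ⟨f (p ++ [.appL]), L, τ (p ++ [.appL]) ++ .pos l :: T, .up⟩
      ⟨f (p ++ [.appR]), l :: L, τ (p ++ [.appR]) ++ T, .down⟩
  var_in : ∀ b d Ln L T, kindAt u (z ++ (b ++ .lam :: d)) = some (.var (nb d)) →
    Ln.length = nl d →
    Reach w ⟨f (b ++ .lam :: d), Ln ++ L, τ (b ++ .lam :: d) ++ T, .down⟩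
      ⟨f b, L, τ b ++ .pos (.mk (f b) (f (b ++ .lam :: d)) Ln) :: T, .up⟩
  sub_in : ∀ b d Ln L T, kindAt u (z ++ (b ++ .esL :: d)) = some (.var (nb d)) →
    Ln.length = nl d →
    Reach w ⟨f (b ++ .esL :: d), Ln ++ L, τ (b ++ .esL :: d) ++ T, .down⟩
      ⟨f (b ++ [.esR]), .mk (f b) (f (b ++ .esL :: d)) Ln :: L, τ (b ++ [.esR]) ++ T, .down⟩
  -- The binder lies above `z`, so the log extension `c` belongs to the path from binder to variable
  -- and is stored in the logged position. The remaining log is empty because `z` has level `0`.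
  var_cross : ∀ b z' p Ln T, z = b ++ .lam :: z' →
    kindAt u (z ++ p) = some (.var (nb z' + nb p)) → Ln.length = nl p →
    Reach w ⟨f p, Ln ++ c, τ p ++ T, .down⟩ ⟨b, [], .pos (.mk b (f p) (Ln ++ c)) :: T, .up⟩
  sub_cross : ∀ b z' p Ln T, z = b ++ .esL :: z' →
    kindAt u (z ++ p) = some (.var (nb z' + nb p)) → Ln.length = nl p →
    Reach w ⟨f p, Ln ++ c, τ p ++ T, .down⟩ ⟨b ++ [.esR], [.mk b (f p) (Ln ++ c)], T, .down⟩

namespace Local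

variable {u w : Tm} (S : Local u w)

/-- The image of an address. -/
def φ (q : Path) : Path := if S.z <+: q then S.f (q.drop S.z.length) else q

/-- The extension of the log at an address. -/
def e (q : Path) : List LP := if S.z <+: q then S.c else []

/-- The extension of the tape at an address. -/
def σ (q : Path) : List PTape := if S.z <+: q then S.τ (q.drop S.z.length) else []

@[simp] theorem φ_in (p : Path) : S.φ (S.z ++ p) = S.f p := by simp [φ]
@[simp] theorem e_in (p : Path) : S.e (S.z ++ p) = S.c := by simp [e]
@[simp] theorem σ_in (p : Path) : S.σ (S.z ++ p) = S.τ p := by simp [σ]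
theorem φ_out {q : Path} (h : ¬ S.z <+: q) : S.φ q = q := by simp [φ, h]
theorem e_out {q : Path} (h : ¬ S.z <+: q) : S.e q = [] := by simp [e, h]
theorem σ_out {q : Path} (h : ¬ S.z <+: q) : S.σ q = [] := by simp [σ, h]

/-- The image of a logged position. -/
def mapLP : LP → LP
  | .mk b v Ln => .mk (S.φ b) (S.φ v)
      -- The extension is part of the logged segment exactly if this segment enters the address `z`.
      (Ln.map mapLP ++ if S.z <+: v ∧ ¬ S.z <+: b then S.c else [])

/-- The image of an element of the tape. -/
def mapT : PTape → PTape
  | .p => .p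
  | .pos l => .pos (S.mapLP l)

/-- The image of a state. -/
def mapS (s : PState) : PState :=
  ⟨S.φ s.path, s.log.map S.mapLP ++ S.e s.path, S.σ s.path ++ s.tape.map S.mapT, s.dir⟩

theorem mapLP_mk (b v : Path) (Ln : List LP) : S.mapLP (.mk b v Ln) = .mk (S.φ b) (S.φ v)
    (Ln.map S.mapLP ++ if S.z <+: v ∧ ¬ S.z <+: b then S.c else []) := by
  rw [mapLP]

theorem mapLP_same {b v : Path} (h : S.z <+: v → S.z <+: b) (Ln : List LP) :
    S.mapLP (.mk b v Ln) = .mk (S.φ b) (S.φ v) (Ln.map S.mapLP) := by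
  rw [mapLP, if_neg (by tauto), List.append_nil]

theorem mapS_flip (s : PState) : S.mapS s.flip = (S.mapS s).flip := rfl

/-- The child may be `z` itself; its image is then only reached after the run `enter`. -/
theorem step_child {q : Path} {x : Sym} {L : List LP} {T T' : List PTape} {d : Dir}
    (hq : ¬ S.z <+: q) (hL : L.length = nl q)
    (h : PFwd w ⟨q, L, T, d⟩ ⟨q ++ [x], L, T', .down⟩) :
    Reach w ⟨q, L, T, d⟩ ⟨S.φ (q ++ [x]), L ++ S.e (q ++ [x]), S.σ (q ++ [x]) ++ T', .down⟩ := by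
  by_cases hz : S.z <+: q ++ [x]
  · have hz' : S.z = q ++ [x] := (List.prefix_concat_iff.1 hz).resolve_right hq
    have h0 := S.nl_z
    rw [hz', nl_append] at h0
    obtain rfl : L = [] := List.eq_nil_of_length_eq_zero (by omega)
    rw [← hz'] at h ⊢
    have h1 := S.φ_in []
    have h2 := S.e_in []
    have h3 := S.σ_in []
    rw [List.append_nil] at h1 h2 h3
    rw [h1, h2, h3, List.nil_append]
    exact h.reach.trans (S.enter T')
  · rw [S.φ_out hz, S.e_out hz, S.σ_out hz, List.append_nil, List.nil_append]
    exact h.reach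

theorem not_prefix_snoc {q : Path} {x : Sym} (hq : ¬ S.z <+: q) (hx : x.lev = 1) :
    ¬ S.z <+: q ++ [x] := by
  intro hz
  have hz' : S.z = q ++ [x] := (List.prefix_concat_iff.1 hz).resolve_right hq
  have h0 := S.nl_z
  rw [hz', nl_append, nl_cons] at h0
  omega

theorem prefix_cases {b d : Path} {x : Sym} (h : ¬ S.z <+: b) (h' : S.z <+: b ++ x :: d) :
    ∃ z' p, S.z = b ++ x :: z' ∧ d = z' ++ p := by
  obtain ⟨p, hp⟩ := h'
  rcases List.append_eq_append_iff.1 hp with ⟨a, h1, h2⟩ | ⟨a, h1, h2⟩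
  · exact (h ⟨a, h1.symm⟩).elim
  · cases a with
    | nil => exact (h ⟨[], by simp [h1]⟩).elim
    | cons y a =>
      simp only [List.cons_append, List.cons.injEq] at h2
      obtain ⟨rfl, rfl⟩ := h2
      exact ⟨a, p, h1, rfl⟩

/-- A step stays inside `z`, stays outside, or crosses its border, and `Local` has a field for each
case in which `z` is involved. The length of the log matters at the border: it forces the log to be
empty at the ancestors of `z`. -/
theorem sim_fwd {s s' : PState} (h : PFwd u s s') (hL : s.log.length = nl s.path) :
    Reach w (S.mapS s) (S.mapS s') := by
  cases h with
  | app q L T hk =>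
    by_cases hq : S.z <+: q
    · obtain ⟨p, rfl⟩ := hq
      simpa [mapS, mapT] using S.app_in p (L.map S.mapLP ++ S.c) (T.map S.mapT) hk
    · have := S.step_child hq (by simpa using hL)
        (PFwd.app q (L.map S.mapLP) (T.map S.mapT) (by rw [S.kind_out q hq, hk]))
      simpa [mapS, mapT, S.φ_out hq, S.e_out hq, S.σ_out hq] using this
  | lam q L T hk =>
    by_cases hq : S.z <+: q
    · obtain ⟨p, rfl⟩ := hq
      simpa [mapS, mapT] using S.lam_in p (L.map S.mapLP ++ S.c) (T.map S.mapT) hk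
    · have := S.step_child hq (by simpa using hL)
        (PFwd.lam q (L.map S.mapLP) (T.map S.mapT) (by rw [S.kind_out q hq, hk]))
      simpa [mapS, mapT, S.φ_out hq, S.e_out hq, S.σ_out hq] using this
  | es q L T hk =>
    by_cases hq : S.z <+: q
    · obtain ⟨p, rfl⟩ := hq
      simpa [mapS, mapT] using S.es_in p (L.map S.mapLP ++ S.c) (T.map S.mapT) hk
    · have := S.step_child hq (by simpa using hL)
        (PFwd.es q (L.map S.mapLP) (T.map S.mapT) (by rw [S.kind_out q hq, hk]))
      simpa [mapS, mapT, S.φ_out hq, S.e_out hq, S.σ_out hq] using this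
  | var b d Ln L T hk hl =>
    by_cases hb : S.z <+: b
    · have hm := S.mapLP_same (v := b ++ .lam :: d) (fun _ => hb) Ln
      obtain ⟨p, rfl⟩ := hb
      have := S.var_in p d (Ln.map S.mapLP) (L.map S.mapLP ++ S.c) (T.map S.mapT)
        (by simpa using hk) (by simpa using hl)
      rw [List.append_assoc] at hm
      simpa [mapS, mapT, hm] using this
    · by_cases hv : S.z <+: b ++ .lam :: d
      · have hm := S.mapLP_mk b (b ++ .lam :: d) Ln
        obtain ⟨z', p, hz, rfl⟩ := S.prefix_cases hb hv
        have h0 := S.nl_z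
        rw [hz] at h0
        simp only [nl_append, nl_cons, lev_lam, List.length_append] at h0 hL hl
        obtain rfl : L = [] := List.eq_nil_of_length_eq_zero (by omega)
        have hzp : b ++ .lam :: (z' ++ p) = S.z ++ p := by simp [hz]
        rw [if_pos ⟨hv, hb⟩] at hm
        rw [hzp] at hk hm ⊢
        have := S.var_cross b z' p (Ln.map S.mapLP) (T.map S.mapT) hz (by simpa using hk)
          (by rw [List.length_map]; omega)
        simpa [mapS, mapT, hm, S.φ_out hb, S.e_out hb, S.σ_out hb] using this
      · have := PFwd.var b d (Ln.map S.mapLP) (L.map S.mapLP) (T.map S.mapT)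
          (by rw [S.kind_out _ hv, hk]) (by simpa using hl)
        have hm := S.mapLP_same (b := b) (fun h => (hv h).elim) Ln
        simpa [mapS, mapT, hm, S.φ_out hb, S.e_out hb, S.σ_out hb, S.φ_out hv, S.e_out hv,
          S.σ_out hv] using this.reach
  | sub b d Ln L T hk hl =>
    by_cases hb : S.z <+: b
    · have hm := S.mapLP_same (v := b ++ .esL :: d) (fun _ => hb) Ln
      obtain ⟨p, rfl⟩ := hb
      have := S.sub_in p d (Ln.map S.mapLP) (L.map S.mapLP ++ S.c) (T.map S.mapT)
        (by simpa using hk) (by simpa using hl)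
      rw [List.append_assoc] at hm
      simpa [mapS, mapT, hm] using this
    · have hb' := S.not_prefix_snoc (x := .esR) hb rfl
      by_cases hv : S.z <+: b ++ .esL :: d
      · have hm := S.mapLP_mk b (b ++ .esL :: d) Ln
        obtain ⟨z', p, hz, rfl⟩ := S.prefix_cases hb hv
        have h0 := S.nl_z
        rw [hz] at h0
        simp only [nl_append, nl_cons, lev_esL, List.length_append] at h0 hL hl
        obtain rfl : L = [] := List.eq_nil_of_length_eq_zero (by omega)
        have hzp : b ++ .esL :: (z' ++ p) = S.z ++ p := by simp [hz]
        rw [if_pos ⟨hv, hb⟩] at hm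
        rw [hzp] at hk hm ⊢
        have := S.sub_cross b z' p (Ln.map S.mapLP) (T.map S.mapT) hz (by simpa using hk)
          (by rw [List.length_map]; omega)
        simpa [mapS, mapT, hm, S.φ_out hb, S.φ_out hb', S.e_out hb', S.σ_out hb'] using this
      · have := PFwd.sub b d (Ln.map S.mapLP) (L.map S.mapLP) (T.map S.mapT)
          (by rw [S.kind_out _ hv, hk]) (by simpa using hl)
        have hm := S.mapLP_same (b := b) (fun h => (hv h).elim) Ln
        simpa [mapS, mapT, hm, S.φ_out hb, S.φ_out hb', S.e_out hb', S.σ_out hb', S.φ_out hv,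
          S.e_out hv, S.σ_out hv] using this.reach
  | arg q l L T hk =>
    by_cases hq : S.z <+: q
    · obtain ⟨p, rfl⟩ := hq
      simpa [mapS, mapT] using S.arg_in p (S.mapLP l) (L.map S.mapLP ++ S.c) (T.map S.mapT) hk
    · have hr := S.not_prefix_snoc (x := .appR) hq rfl
      have h1 : Reach w ⟨q ++ [.appL], L.map S.mapLP, .pos (S.mapLP l) :: T.map S.mapT, .up⟩
          ⟨q ++ [.appR], S.mapLP l :: L.map S.mapLP, T.map S.mapT, .down⟩ :=
        (PFwd.arg q (S.mapLP l) (L.map S.mapLP) (T.map S.mapT)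
          (by rw [S.kind_out q hq, hk])).reach
      by_cases hz : S.z <+: q ++ [.appL]
      · have hz' : S.z = q ++ [.appL] := (List.prefix_concat_iff.1 hz).resolve_right hq
        have h0 := S.nl_z
        rw [hz'] at h0
        simp only [nl_append, nl_cons, lev_appL] at h0 hL
        obtain rfl : L = [] := List.eq_nil_of_length_eq_zero (by omega)
        have h2 := S.φ_in []
        have h3 := S.e_in []
        have h4 := S.σ_in []
        rw [List.append_nil, hz'] at h2 h3 h4
        have h5 := (S.enter (.pos (S.mapLP l) :: T.map S.mapT)).flip
        rw [hz'] at h5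
        simpa [mapS, mapT, h2, h3, h4, S.φ_out hr, S.e_out hr, S.σ_out hr] using h5.trans h1
      · simpa [mapS, mapT, S.φ_out hz, S.e_out hz, S.σ_out hz, S.φ_out hr, S.e_out hr, S.σ_out hr]
          using h1

theorem sim {s s' : PState} (h : PStep u s s') (hs : Good u s) :
    Reach w (S.mapS s) (S.mapS s') := by
  rcases h with h | h
  · exact S.sim_fwd h hs.1.length
  · have h1 : Good u s'.flip := Good.flip.2 (hs.step (.inr h))
    simpa [mapS_flip] using (S.sim_fwd h h1.1.length).flip

theorem sim_run {n : ℕ} {s s' : PState} (h : PRun u n s s') (hs : Good u s) :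
    ∃ m, n ≤ m ∧ PRun w m (S.mapS s) (S.mapS s') := by
  induction h with
  | refl => exact ⟨0, le_rfl, .refl _⟩
  | head h1 _ ih =>
    obtain ⟨m, hm, h2⟩ := ih (hs.step h1)
    obtain ⟨m', hm', h3⟩ := S.sim h1 hs
    exact ⟨m' + m, by omega, h3.trans h2⟩

/-- A simulation that starts with a longer run gives longer runs. -/
theorem longer {k a b : ℕ} {s : PState} (ha : PRun u a (pinit k) s)
    (hb : PRun w b (pinit k) (S.mapS s)) (hab : a < b) (n : ℕ) (r : PState)
    (hr : PRun u n (pinit k) r) : ∃ m r', n < m ∧ PRun w m (pinit k) r' := by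
  rcases Nat.lt_or_ge n b with h | h
  · exact ⟨b, _, h, hb⟩
  · obtain ⟨j, rfl⟩ := Nat.exists_eq_add_of_le (show a ≤ n by omega)
    have hg : ∀ {i : ℕ} {x y : PState}, PRun u i x y → Good u x → Good u y := by
      intro i x y hxy
      induction hxy with
      | refl => exact id
      | head h1 _ ih => exact fun hx => ih (hx.step h1)
    obtain ⟨m, hm, h1⟩ := S.sim_run (ha.split hr) (hg ha (Good.init u k))
    exact ⟨b + m, _, by omega, hb.trans h1⟩

end Local


/-! ### Constructors under plugging and shifting -/

theorem kindAt_plug_out {C : Ctx} {q : Path} (h : ¬ C.path <+: q) (t t' : Tm) :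
    kindAt (C.plug t) q = kindAt (C.plug t') q := by
  induction C generalizing q with
  | hole => exact (h (by simp [Ctx.path])).elim
  | lam C ih | appL C _ ih | esL C _ ih | appR _ C ih | esR _ C ih =>
    cases q with
    | nil => rfl
    | cons x q =>
      cases x <;> simp only [Ctx.plug, kindAt]
      exact ih (by simpa [Ctx.path] using h)

/-- The effect of `Tm.lift` on the constructor at an address. -/
def Kind.lift (d c : ℕ) : Kind → Kind
  | .var i => if i < c then .var i else .var (i + d)
  | k => k

theorem kindAt_lift (d c : ℕ) (t : Tm) (p : Path) :
    kindAt (t.lift d c) p = (kindAt t p).map (Kind.lift d (c + nb p)) := by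
  induction t generalizing c p with
  | var i =>
    cases p with
    | nil => simp only [Tm.lift]; split <;> simp_all [kindAt, Kind.lift]
    | cons x p => cases x <;> simp only [Tm.lift] <;> split <;> simp [kindAt]
  | lam t ih =>
    cases p with
    | nil => simp [Tm.lift, kindAt, Kind.lift]
    | cons x p => cases x <;> simp [Tm.lift, kindAt, ih, add_assoc]
  | app t u ih ih' | es t u ih ih' =>
    cases p with
    | nil => simp [Tm.lift, kindAt, Kind.lift]
    | cons x p => cases x <;> simp [Tm.lift, kindAt, ih, ih', add_assoc]

theorem kindAt_shift (d : ℕ) (t : Tm) (p : Path) :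
    kindAt (t.shift d) p = (kindAt t p).map (Kind.lift d (nb p)) := by
  simpa [Tm.shift] using kindAt_lift d 0 t p

theorem Kind.lift_eq_var {d c i : ℕ} {k : Kind} (h : k.lift d c = .var i) :
    (i < c ∧ k = .var i) ∨ (c + d ≤ i ∧ k = .var (i - d)) := by
  cases k with
  | var j =>
    simp only [Kind.lift] at h
    split at h
    · cases h; left; exact ⟨by assumption, rfl⟩
    · cases h; right; exact ⟨by omega, by simp⟩
  | _ => simp [Kind.lift] at h

theorem Kind.lift_eq {d c : ℕ} {k k' : Kind} (h : k.lift d c = k') (hk : ∀ i, k' ≠ .var i) :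
    k = k' := by
  cases k with
  | var j =>
    simp only [Kind.lift] at h
    split at h
    · exact (hk _ h.symm).elim
    · exact (hk _ h.symm).elim
  | _ => simpa [Kind.lift] using h

/-! ### Reaching the modified address, and the comparison of lengths -/

/-- The number of symbols `p` on the tape after a path of level `0`. -/
def outTape : Path → ℕ → ℕ
  | [], k => k
  | .lam :: q, k => outTape q (k - 1)
  | .appL :: q, k => outTape q (k + 1)
  | _ :: q, k => outTape q k

/-- A path of level `0` never enters an argument, so only abstractions can block the descent, and
each takes one `p`. The bound by `nb p` also keeps the truncated subtraction in `outTape` harmless.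
-/
theorem descend {w : Tm} {q p : Path} {k : ℕ} (hp : nl p = 0) (hk : nb p ≤ k)
    (h : ∀ p' x r, p = p' ++ x :: r → kindAt w (q ++ p') = some x.parent) :
    PRun w p.length ⟨q, [], List.replicate k .p, .down⟩
      ⟨q ++ p, [], List.replicate (outTape p k) .p, .down⟩ := by
  induction p generalizing q k with
  | nil => simpa [outTape] using PRun.refl _
  | cons x p ih =>
    have h0 := h [] x p rfl
    rw [List.append_nil] at h0
    simp only [nl_cons, nb_cons] at hp hk
    have h1 (j : ℕ) (hj : nb p ≤ j) := ih (q := q ++ [x]) (k := j) (by omega) hj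
      (fun p' y r hr => by simpa using h (x :: p') y r (by simp [hr]))
    simp only [List.append_assoc, List.singleton_append] at h1
    cases x with
    | lam =>
      obtain ⟨j, rfl⟩ := Nat.exists_eq_add_of_le hk
      simp only [binds_lam] at hk ⊢
      have h2 := PFwd.lam q [] (List.replicate (nb p + j) .p) h0
      have h3 : List.replicate (1 + nb p + j) PTape.p = .p :: List.replicate (nb p + j) .p := by
        rw [← List.replicate_succ]; congr 1; omega
      rw [h3]
      have h4 : outTape (.lam :: p) (1 + nb p + j) = outTape p (nb p + j) := by
        simp only [outTape]; congr 1; omega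
      rw [h4]
      exact .head (.inl h2) (h1 _ (by omega))
    | appL =>
      exact .head (.inl (PFwd.app q [] _ h0)) (h1 (k + 1) (by simp at hk; omega))
    | esL =>
      exact .head (.inl (PFwd.es q [] _ h0)) (h1 k (by simp at hk; omega))
    | appR => simp at hp
    | esR => simp at hp

namespace Local

variable {u w : Tm} (S : Local u w)

theorem runLength_lt {k₀ : Kind} (hz : kindAt u S.z = some k₀) : ∃ k, ∀ h, k ≤ h →
    runLength w h ≠ ⊤ → runLength u h < runLength w h := by
  -- Explicit substitutions are counted as well, so this depth is sufficient but not necessarily the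
  -- least one.
  refine ⟨nb S.z, fun h hh => LIAM.runLength_lt ?_⟩
  have hu : ∀ p x r, S.z = p ++ x :: r → kindAt u ([] ++ p) = some x.parent := by
    intro p x r hr
    rw [hr] at hz
    simpa using kindAt_parent hz
  have hw : ∀ p x r, S.z = p ++ x :: r → kindAt w ([] ++ p) = some x.parent := by
    intro p x r hr
    rw [← hu p x r hr, List.nil_append]
    refine S.kind_out p fun h => ?_
    have := h.length_le
    rw [hr] at this
    simp at this
  have h1 := descend S.nl_z hh hu
  have h2 := descend S.nl_z hh hw
  rw [List.nil_append] at h1 h2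
  obtain ⟨n, hn, h3⟩ := S.enter (List.replicate (outTape S.z h) .p)
  -- Both machines reach `z` after `S.z.length` transitions; the one on `w` needs `n ≥ 1` more to
  -- reach the image of that state.
  refine S.longer h1 (b := S.z.length + n) ?_ (by omega)
  have h4 : S.mapS ⟨S.z, [], List.replicate (outTape S.z h) .p, .down⟩ =
      ⟨S.f [], S.c, S.τ [] ++ List.replicate (outTape S.z h) .p, .down⟩ := by
    have h5 := S.φ_in []
    have h6 := S.e_in []
    have h7 := S.σ_in []
    rw [List.append_nil] at h5 h6 h7
    simp [mapS, h5, h6, h7, mapT]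
  rw [h4]
  exact h2.trans h3

end Local

/-! ### Garbage collection and linear substitution -/

/-- The simulation when the subterm at the address `C.path` of `u` is a copy of the subterm at the
address `y` of `w`. -/
def Local.ofCopy (C : Ctx) (a b : Tm) (y : Path) (c : List LP) (hC : C.level = 0)
    (enter : ∀ T, Reach (C.plug b) ⟨C.path, [], T, .down⟩ ⟨y, c, T, .down⟩)
    (inner : ∀ p k, kindAt a p = some k → (∀ i, k = .var i → i < nb p) →
      kindAt (C.plug b) (y ++ p) = some k)
    (cross : ∀ q x z p, C.path = q ++ x :: z → x.binds = 1 →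
      kindAt a p = some (.var (nb z + nb p)) → ∃ y', y = q ++ x :: y' ∧
        kindAt (C.plug b) (y ++ p) = some (.var (nb y' + nb p)) ∧ nl y' = c.length) :
    Local (C.plug a) (C.plug b) where
  z := C.path
  f p := y ++ p
  c := c
  τ _ := []
  nl_z := by simp [hC]
  kind_out q hq := kindAt_plug_out hq _ _
  enter T := by simpa using enter T
  app_in p L T h := by
    rw [kindAt_plug_append] at h
    have := PFwd.app _ L T (inner p _ h (by simp))
    simpa using this.reach
  lam_in p L T h := by
    rw [kindAt_plug_append] at h
    have := PFwd.lam _ L T (inner p _ h (by simp))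
    simpa using this.reach
  es_in p L T h := by
    rw [kindAt_plug_append] at h
    have := PFwd.es _ L T (inner p _ h (by simp))
    simpa using this.reach
  arg_in p l L T h := by
    rw [kindAt_plug_append] at h
    have := PFwd.arg _ l L T (inner p _ h (by simp))
    simpa using this.reach
  var_in q d Ln L T h hl := by
    rw [kindAt_plug_append] at h
    have := inner _ _ h (by simp; omega)
    rw [← List.append_assoc] at this
    have := PFwd.var _ _ Ln L T this hl
    simpa using this.reach
  sub_in q d Ln L T h hl := by
    rw [kindAt_plug_append] at h
    have := inner _ _ h (by simp; omega)
    rw [← List.append_assoc] at this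
    have := PFwd.sub _ _ Ln L T this hl
    simpa using this.reach
  var_cross q z p Ln T hz h hl := by
    rw [kindAt_plug_append] at h
    obtain ⟨y', rfl, h1, h2⟩ := cross q _ z p hz rfl h
    rw [← nb_append, List.append_assoc, List.cons_append] at h1
    have := PFwd.var q (y' ++ p) (Ln ++ c) [] T h1 (by simp; omega)
    simpa using this.reach
  sub_cross q z p Ln T hz h hl := by
    rw [kindAt_plug_append] at h
    obtain ⟨y', rfl, h1, h2⟩ := cross q _ z p hz rfl h
    rw [← nb_append, List.append_assoc, List.cons_append] at h1
    have := PFwd.sub q (y' ++ p) (Ln ++ c) [] T h1 (by simp; omega)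
    simpa using this.reach

theorem exists_kindAt_nil (t : Tm) : ∃ k, kindAt t [] = some k := by
  cases t <;> simp [kindAt]

/-- The term is simulated by its shifted copy under the useless substitution, and the additional
transition is `es`. Shifting accounts for the binder that is crossed in addition. -/
theorem runLength_lt_gc (H : Ctx) (t v : Tm) (hH : H.level = 0) : ∃ k, ∀ h, k ≤ h →
    runLength (H.plug (.es (t.shift 1) v)) h ≠ ⊤ →
      runLength (H.plug t) h < runLength (H.plug (.es (t.shift 1) v)) h := by
  obtain ⟨k, hk⟩ := exists_kindAt_nil t
  have key (p : Path) : kindAt (H.plug (.es (t.shift 1) v)) (H.path ++ [.esL] ++ p) =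
      (kindAt t p).map (Kind.lift 1 (nb p)) := by
    rw [List.append_assoc, kindAt_plug_append, ← kindAt_shift]
    rfl
  refine (Local.ofCopy H t (.es (t.shift 1) v) (H.path ++ [.esL]) [] hH ?_ ?_ ?_).runLength_lt
    (k₀ := k) (by rw [← hk, ← kindAt_plug H]; rfl)
  · intro T
    exact (PFwd.es _ [] T (by rw [kindAt_plug]; rfl)).reach
  · intro p k h hv
    rw [key, h, Option.map_some]
    cases k with
    | var i => simp [Kind.lift, hv i rfl]
    | _ => rfl
  · intro q x z p hz hx h
    refine ⟨z ++ [.esL], by simp [hz], ?_, ?_⟩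
    · rw [key, h, Option.map_some]
      simp [Kind.lift]
      omega
    · have h0 := H.nl_path
      rw [hz, hH] at h0
      simp at h0 ⊢
      omega

/-- The substituted copy is simulated by the original inside the substitution, which is entered from
the variable by `sub`. The log extension is the position of this variable; its own log is empty as
`E` has level `0`. -/
theorem runLength_lt_ls (H E : Ctx) (t : Tm) (hH : H.level = 0) (hE : E.level = 0) :
    ∃ k, ∀ h, k ≤ h → runLength (H.plug (.es (E.plug (.var E.binders)) t)) h ≠ ⊤ →
      runLength (H.plug (.es (E.plug (t.shift (E.binders + 1))) t)) h <
        runLength (H.plug (.es (E.plug (.var E.binders)) t)) h := by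
  obtain ⟨k, hk⟩ := exists_kindAt_nil (t.shift (E.binders + 1))
  have h1 (s : Tm) : H.plug (.es (E.plug s) t) = (H.comp (.esL E t)).plug s := by
    simp [Ctx.plug]
  have hpath : (H.comp (.esL E t)).path = H.path ++ .esL :: E.path := by simp [Ctx.path]
  have key (p : Path) : kindAt ((H.comp (.esL E t)).plug (.var E.binders))
      (H.path ++ [.esR] ++ p) = kindAt t p := by
    rw [← h1, List.append_assoc, kindAt_plug_append]
    rfl
  rw [h1, h1]
  refine (Local.ofCopy (H.comp (.esL E t)) (t.shift (E.binders + 1)) (.var E.binders)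
    (H.path ++ [.esR]) [.mk H.path (H.path ++ .esL :: E.path) []] ?_ ?_ ?_ ?_).runLength_lt
    (k₀ := k) (by rw [← hk, ← kindAt_plug (H.comp (.esL E t))]; rfl)
  · rw [← Ctx.nl_path, hpath]
    simp [hH, hE]
  · intro T
    rw [hpath]
    refine (PFwd.sub H.path E.path [] [] T ?_ (by simp [hE])).reach
    rw [← hpath, kindAt_plug, Ctx.nb_path]
    rfl
  · intro p k h hv
    rw [key]
    rw [kindAt_shift, Option.map_eq_some_iff] at h
    obtain ⟨k', h2, h3⟩ := h
    rw [h2]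
    cases k with
    | var i =>
      rcases Kind.lift_eq_var h3 with ⟨-, rfl⟩ | ⟨h4, -⟩
      · rfl
      · have := hv i rfl
        omega
    | _ => rw [Kind.lift_eq h3 (by simp)]
  · intro q x z p hz hx h
    rw [hpath] at hz
    rw [kindAt_shift, Option.map_eq_some_iff] at h
    obtain ⟨k', h2, h3⟩ := h
    have h0 := E.nb_path
    rcases Kind.lift_eq_var h3 with ⟨h4, -⟩ | ⟨h4, rfl⟩
    · omega
    · have h5 : ∃ z', H.path = q ++ x :: z' ∧ z = z' ++ .esL :: E.path := by
        rcases List.append_eq_append_iff.1 hz with ⟨a, h5, h6⟩ | ⟨a, h5, h6⟩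
        · have := congrArg nb h6
          simp at this
          omega
        · cases a with
          | nil =>
            have := congrArg nb h6
            simp at this
            omega
          | cons y a =>
            simp only [List.cons_append, List.cons.injEq] at h6
            obtain ⟨rfl, rfl⟩ := h6
            exact ⟨a, h5, rfl⟩
      obtain ⟨z', h5, rfl⟩ := h5
      refine ⟨z' ++ [.esR], by simp [h5], ?_, ?_⟩
      · rw [key, h2]
        simp
        omega
      · have h6 := H.nl_path
        rw [h5, hH] at h6
        simp at h6 ⊢
        omega


/-! ### Beta at a distance -/

theorem Ctx.IsSubst.path_eq {S : Ctx} (hS : S.IsSubst) {x : Sym} (hx : x ∈ S.path) :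
    x = .esL := by
  induction hS with
  | hole => simp [path] at hx
  | esL S t _ ih =>
    simp only [path, List.mem_cons] at hx
    exact hx.elim id ih

theorem Ctx.IsSubst.level_eq {S : Ctx} (hS : S.IsSubst) : S.level = 0 := by
  induction hS with
  | hole => rfl
  | esL S t _ ih => exact ih

theorem spine_run {w : Tm} {q r : Path} {k : Kind} (hr : ∀ x ∈ r, x = .esL)
    (hk : kindAt w (q ++ r) = some k) (L : List LP) (T : List PTape) :
    PRun w r.length ⟨q, L, T, .down⟩ ⟨q ++ r, L, T, .down⟩ := by
  induction r generalizing q with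
  | nil => simpa using PRun.refl _
  | cons x r ih =>
    obtain rfl := hr x (by simp)
    have h1 := ih (q := q ++ [.esL]) (fun y hy => hr y (by simp [hy])) (by simpa using hk)
    rw [List.append_assoc] at h1
    exact .head (.inl (.es q L T (kindAt_parent hk))) h1

/-- The address in `(S⟨λx.t⟩) v` of the subterm at the address `p` of `S⟨t[x←v]⟩`, where `r` is the
address of the hole of `S`, and `z` that of the whole term. -/
def dbAddr (z r p : Path) : Path :=
  if r ++ [.esL] <+: p then z ++ .appL :: (r ++ .lam :: p.drop (r.length + 1))
  else if r ++ [.esR] <+: p then z ++ .appR :: p.drop (r.length + 1)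
  else z ++ .appL :: p

theorem dbAddr_body (z r p : Path) :
    dbAddr z r (r ++ .esL :: p) = z ++ .appL :: (r ++ .lam :: p) := by
  have h : r ++ [.esL] <+: r ++ .esL :: p := ⟨p, by simp⟩
  rw [dbAddr, if_pos h, ← List.append_cancel_left_eq z]
  simp [List.drop_append]

theorem dbAddr_arg (z r p : Path) : dbAddr z r (r ++ .esR :: p) = z ++ .appR :: p := by
  have h : r ++ [.esR] <+: r ++ .esR :: p := ⟨p, by simp⟩
  have h' : ¬ r ++ [.esL] <+: r ++ .esR :: p := by
    rw [List.prefix_append_right_inj]; simp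
  rw [dbAddr, if_neg h', if_pos h]
  simp [List.drop_append]

theorem dbAddr_out {z r p : Path} (h : ¬ r <+: p) : dbAddr z r p = z ++ .appL :: p := by
  rw [dbAddr, if_neg fun h' => h ((List.prefix_append _ _).trans h'),
    if_neg fun h' => h ((List.prefix_append _ _).trans h')]

theorem dbAddr_spine {z r p : Path} (h : p <+: r) : dbAddr z r p = z ++ .appL :: p := by
  have key (x : Sym) : ¬ r ++ [x] <+: p := fun h' => by
    have := (h'.trans h).length_le
    simp at this
  rw [dbAddr, if_neg (key _), if_neg (key _)]

/-- Only the nodes on the path to the hole of `S` are rearranged; subtrees that hang off this spine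
are moved as a whole. -/
theorem dbAddr_append {z r p : Path} (h : ¬ p <+: r) (d : Path) :
    dbAddr z r (p ++ d) = dbAddr z r p ++ d := by
  by_cases hr : r <+: p
  · obtain ⟨q, rfl⟩ := hr
    cases q with
    | nil => exact (h (by simp)).elim
    | cons x q =>
      rw [List.append_assoc, List.cons_append]
      cases x
      case esL => simp [dbAddr_body]
      case esR => simp [dbAddr_arg]
      all_goals simp [dbAddr, List.prefix_append_right_inj]
  · rw [dbAddr_out hr, dbAddr_out]
    · simp
    · intro h'
      rcases List.prefix_or_prefix_of_prefix h' (List.prefix_append p d) with h1 | h1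
      · exact hr h1
      · exact h h1

section

variable {S : Ctx} {t v v' : Tm} {p : Path} {k : Kind}

theorem kindAt_spine (hp : p <+: S.path) (hS : S.IsSubst) :
    kindAt (S.plug (.es t v)) p = some .es := by
  have h : kindAt (S.plug (.es t v)) S.path = some .es := by rw [kindAt_plug]; rfl
  obtain ⟨q, hq⟩ := hp
  cases q with
  | nil => rw [← h, ← hq, List.append_nil]
  | cons x q =>
    obtain rfl := hS.path_eq (x := x) (by simp [← hq])
    rw [← hq] at h
    exact kindAt_parent h

theorem kindAt_db_cases (h : kindAt (S.plug (.es t v)) p = some k) :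
    (∃ q, p = S.path ++ .esL :: q ∧ kindAt t q = some k) ∨
    (∃ q, p = S.path ++ .esR :: q ∧ kindAt v q = some k) ∨
    (p = S.path ∧ k = .es) ∨
    (¬ S.path <+: p ∧ kindAt (S.plug (.lam t)) p = some k) := by
  by_cases hp : S.path <+: p
  · obtain ⟨q, rfl⟩ := hp
    rw [kindAt_plug_append] at h
    cases q with
    | nil => simp_all [kindAt]
    | cons x q => cases x <;> simp_all [kindAt]
  · exact .inr (.inr (.inr ⟨hp, by rw [← h, kindAt_plug_out hp]⟩))

theorem kindAt_redex_appL (H : Ctx) (s v : Tm) (p : Path) :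
    kindAt (H.plug (.app s v)) (H.path ++ .appL :: p) = kindAt s p := by
  rw [kindAt_plug_append]; rfl

theorem kindAt_redex_appR (H : Ctx) (s v : Tm) (p : Path) :
    kindAt (H.plug (.app s v)) (H.path ++ .appR :: p) = kindAt v p := by
  rw [kindAt_plug_append]; rfl

theorem kindAt_redex_body (H S : Ctx) (t v : Tm) (p : Path) :
    kindAt (H.plug (.app (S.plug (.lam t)) v)) (H.path ++ .appL :: (S.path ++ .lam :: p)) =
      kindAt t p := by
  rw [kindAt_redex_appL, kindAt_plug_append]; rfl

/-- Two places have to be excluded: the hole of `S`, where a substitution becomes an abstraction,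
and variables of the argument bound outside it, whose index is shifted. -/
theorem kindAt_dbAddr (H : Ctx) {n : ℕ} (h : kindAt (S.plug (.es t (v.shift n))) p = some k)
    (hp : p ≠ S.path) (hk : ∀ i q, k = .var i → p = S.path ++ .esR :: q → i < nb q) :
    kindAt (H.plug (.app (S.plug (.lam t)) v)) (dbAddr H.path S.path p) = some k := by
  rcases kindAt_db_cases h with ⟨q, rfl, h1⟩ | ⟨q, rfl, h1⟩ | ⟨h1, -⟩ | ⟨h1, h2⟩
  · rw [dbAddr_body, kindAt_redex_body, h1]
  · rw [dbAddr_arg, kindAt_redex_appR]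
    rw [kindAt_shift, Option.map_eq_some_iff] at h1
    obtain ⟨k', h2, h3⟩ := h1
    rw [h2]
    cases k with
    | var i =>
      have := hk i q rfl rfl
      rcases Kind.lift_eq_var h3 with ⟨-, rfl⟩ | ⟨h4, -⟩
      · rfl
      · omega
    | _ => rw [Kind.lift_eq h3 (by simp)]
  · exact (hp h1).elim
  · rw [dbAddr_out h1, kindAt_redex_appL, h2]

/-- Variables that are bound outside of the redex. -/
theorem kindAt_dbAddr_cross (H : Ctx) {b z : Path} {x : Sym} (hS : S.IsSubst) (hH : H.level = 0)
    (hz : H.path = b ++ x :: z)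
    (h : kindAt (S.plug (.es t (v.shift S.binders))) p = some (.var (nb z + nb p))) :
    ∃ d, dbAddr H.path S.path p = b ++ x :: d ∧ nl d = nl p ∧
      kindAt (H.plug (.app (S.plug (.lam t)) v)) (dbAddr H.path S.path p) =
        some (.var (nb d)) := by
  have h0 := H.nl_path
  rw [hz, hH] at h0
  simp only [nl_append, nl_cons] at h0
  have hl := hS.level_eq
  rcases kindAt_db_cases h with ⟨q, rfl, h1⟩ | ⟨q, rfl, h1⟩ | ⟨-, h1⟩ | ⟨h1, h2⟩
  · refine ⟨z ++ .appL :: (S.path ++ .lam :: q), ?_, ?_, ?_⟩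
    · rw [dbAddr_body, hz]; simp
    · simp; omega
    · rw [dbAddr_body, kindAt_redex_body, h1]; simp
  · refine ⟨z ++ .appR :: q, ?_, ?_, ?_⟩
    · rw [dbAddr_arg, hz]; simp
    · simp; omega
    · rw [dbAddr_arg, kindAt_redex_appR]
      rw [kindAt_shift, Option.map_eq_some_iff] at h1
      obtain ⟨k', h2, h3⟩ := h1
      simp only [nb_append, nb_cons, binds_esR, Ctx.nb_path] at h3
      rcases Kind.lift_eq_var h3 with ⟨h4, -⟩ | ⟨-, rfl⟩
      · omega
      · rw [h2]; simp; omega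
  · simp at h1
  · refine ⟨z ++ .appL :: p, ?_, ?_, ?_⟩
    · rw [dbAddr_out h1, hz]; simp
    · simp; omega
    · rw [dbAddr_out h1, kindAt_redex_appL, h2]; simp

/-- A binder that is not on the spine but has the variable of the argument below it lies in the
argument, so the shift leaves this variable alone. -/
theorem bound_lt_of_not_spine {r b d q : Path} {x : Sym} (hb : ¬ b <+: r) (hx : x.binds = 1)
    (h : b ++ x :: d = r ++ .esR :: q) : nb d < nb q := by
  rcases List.append_eq_append_iff.1 h with ⟨a, h1, -⟩ | ⟨a, h1, h2⟩
  · exact (hb ⟨a, h1.symm⟩).elim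
  · cases a with
    | nil => exact (hb (by simp [h1])).elim
    | cons y a =>
      simp only [List.cons_append, List.cons.injEq] at h2
      rw [h2.2]
      simp
      omega

/-- The extension of the tape for a redex `(S⟨λx.t⟩) v`. -/
def dbTape (r p : Path) : List PTape := if p <+: r then [.p] else []

theorem dbTape_spine {r p : Path} (h : p <+: r) : dbTape r p = [.p] := if_pos h

theorem dbTape_out {r p : Path} (h : ¬ p <+: r) : dbTape r p = [] := if_neg h

theorem not_prefix_append {r p : Path} (h : ¬ p <+: r) (d : Path) : ¬ p ++ d <+: r :=
  fun h' => h ((List.prefix_append _ _).trans h')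

end

/-- All the nodes on the spine are explicit substitutions, so any other constructor is found off the
spine. -/
theorem dbAddr_app {H S : Ctx} {t v : Tm} {n : ℕ} (hS : S.IsSubst) {p : Path} {k : Kind}
    (h : kindAt (S.plug (.es t (v.shift n))) p = some k) (hk : k ≠ .es)
    (hv : ∀ i, k ≠ .var i) :
    ¬ p <+: S.path ∧
      kindAt (H.plug (.app (S.plug (.lam t)) v)) (dbAddr H.path S.path p) = some k := by
  have hp : ¬ p <+: S.path := fun hp => hk (by
    have := kindAt_spine (t := t) (v := v.shift n) hp hS
    rwa [h, Option.some.injEq] at this)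
  exact ⟨hp, kindAt_dbAddr H h (by rintro rfl; simp at hp) fun i _ hi => (hv i hi).elim⟩

/-- The simulation of `H⟨S⟨t[x←v]⟩⟩` by `H⟨S⟨λx.t⟩ v⟩`. -/
def Local.dB (H S : Ctx) (t v : Tm) (hH : H.level = 0) (hS : S.IsSubst) :
    Local (H.plug (S.plug (.es t (v.shift S.binders)))) (H.plug (.app (S.plug (.lam t)) v)) where
  z := H.path
  f := dbAddr H.path S.path
  c := []
  -- On the spine the machine on the redex has crossed the application but not yet the abstraction,
  -- which will consume this `p`.
  τ := dbTape S.path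
  nl_z := by simp [hH]
  kind_out q hq := kindAt_plug_out hq _ _
  enter T := by
    have := PFwd.app (w := H.plug (.app (S.plug (.lam t)) v)) H.path [] T
      (by rw [kindAt_plug]; rfl)
    rw [dbAddr_spine (by simp), dbTape_spine (by simp)]
    exact this.reach
  app_in p L T h := by
    rw [kindAt_plug_append] at h
    obtain ⟨hp, hk⟩ := dbAddr_app (H := H) hS h (by simp) (by simp)
    rw [dbAddr_append hp, dbTape_out hp, dbTape_out (not_prefix_append hp _)]
    exact (PFwd.app _ L T hk).reach
  lam_in p L T h := by
    rw [kindAt_plug_append] at h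
    obtain ⟨hp, hk⟩ := dbAddr_app (H := H) hS h (by simp) (by simp)
    rw [dbAddr_append hp, dbTape_out hp, dbTape_out (not_prefix_append hp _)]
    exact (PFwd.lam _ L T hk).reach
  arg_in p l L T h := by
    rw [kindAt_plug_append] at h
    obtain ⟨hp, hk⟩ := dbAddr_app (H := H) hS h (by simp) (by simp)
    rw [dbAddr_append hp, dbAddr_append hp, dbTape_out (not_prefix_append hp _),
      dbTape_out (not_prefix_append hp _)]
    exact (PFwd.arg _ l L T hk).reach
  es_in p L T h := by
    rw [kindAt_plug_append] at h
    by_cases hp : p = S.path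
    · subst hp
      have h1 := dbAddr_body H.path S.path []
      have h2 : ¬ S.path ++ [.esL] <+: S.path := fun h' => by simpa using h'.length_le
      rw [dbAddr_spine (by simp), dbTape_spine (by simp), h1, dbTape_out h2]
      -- Entering the body of the new substitution corresponds to crossing the abstraction, with the
      -- extra `p`.
      have := PFwd.lam (w := H.plug (.app (S.plug (.lam t)) v)) (H.path ++ .appL :: S.path) L T
        (by rw [kindAt_redex_appL, kindAt_plug]; rfl)
      simpa using this.reach
    · have hk := kindAt_dbAddr H h hp (by simp)
      by_cases hr : p <+: S.path
      · obtain ⟨q, hq⟩ := hr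
        cases q with
        | nil => exact (hp (by simpa using hq)).elim
        | cons x q =>
          obtain rfl := hS.path_eq (x := x) (by simp [← hq])
          have h1 : p ++ [.esL] <+: S.path := ⟨q, by simp [← hq]⟩
          have h2 : p <+: S.path := ⟨_, hq⟩
          rw [dbAddr_spine h2] at hk
          rw [dbAddr_spine h1, dbAddr_spine h2, dbTape_spine h1, dbTape_spine h2]
          simpa using (PFwd.es _ L (.p :: T) hk).reach
      · rw [dbAddr_append hr, dbTape_out hr, dbTape_out (not_prefix_append hr _)]
        exact (PFwd.es _ L T hk).reach
  var_in b d Ln L T h hl := by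
    rw [kindAt_plug_append] at h
    have hb : ¬ b <+: S.path := fun hb => by
      have := kindAt_spine (t := t) (v := v.shift S.binders) hb hS
      rw [kindAt_parent h] at this
      simp at this
    have hk := kindAt_dbAddr H h (by rintro h'; exact hb ⟨_, h'⟩) fun i q hi hq => by
      cases hi
      exact bound_lt_of_not_spine hb rfl hq
    rw [dbAddr_append hb] at hk ⊢
    rw [dbTape_out hb, dbTape_out (not_prefix_append hb _)]
    exact (PFwd.var _ _ Ln L T hk hl).reach
  sub_in b d Ln L T h hl := by
    rw [kindAt_plug_append] at h
    have hv : ¬ b ++ .esL :: d <+: S.path := fun hv => by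
      have := kindAt_spine (t := t) (v := v.shift S.binders) hv hS
      rw [h] at this
      simp at this
    by_cases hb : b <+: S.path
    · rw [dbTape_out hv]
      obtain ⟨r, hr⟩ := id hb
      cases r with
      | nil =>
        obtain rfl : b = S.path := by simpa using hr
        have h1 : ¬ S.path ++ [.esR] <+: S.path := fun h' => by simpa using h'.length_le
        have h2 := dbAddr_arg H.path S.path []
        rw [dbAddr_body, dbAddr_spine hb, h2, dbTape_out h1]
        rw [kindAt_plug_append] at h
        -- The jump from a variable to the new substitution is replayed in three stages: up to the
        -- abstraction, back along the spine of `S`, and over to the argument by `arg`.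
        have h3 := PFwd.var (w := H.plug (.app (S.plug (.lam t)) v)) (H.path ++ .appL :: S.path)
          d Ln L T (by
            rw [List.append_assoc, List.cons_append, kindAt_redex_body]; exact h) hl
        have h4 := (spine_run (w := H.plug (.app (S.plug (.lam t)) v)) (q := H.path ++ [.appL])
          (r := S.path) (k := .lam) (fun x hx => hS.path_eq hx)
          (by rw [List.append_assoc, List.singleton_append, kindAt_redex_appL, kindAt_plug]; rfl)
          L (.pos (.mk (H.path ++ .appL :: S.path) (H.path ++ .appL :: S.path ++ .lam :: d) Ln)
            :: T)).flip
        have h5 := PFwd.arg (w := H.plug (.app (S.plug (.lam t)) v)) H.path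
          (.mk (H.path ++ .appL :: S.path) (H.path ++ .appL :: S.path ++ .lam :: d) Ln) L T
          (by rw [kindAt_plug]; rfl)
        simp only [PState.flip_mk, Dir.flip_down, List.append_assoc,
          List.cons_append] at h3 h4 h5
        exact ⟨_, by omega, (h3.run.trans h4).trans h5.run⟩
      | cons x r =>
        obtain rfl := hS.path_eq (x := x) (by simp [← hr])
        have h1 : ¬ S.path <+: b ++ [.esR] := fun h' => by
          rw [← hr, List.prefix_append_right_inj] at h'
          simp at h'
        have h2 : ¬ b ++ [.esR] <+: S.path := fun h' => by
          rw [← hr, List.prefix_append_right_inj] at h'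
          simp at h'
        rw [dbTape_out h2, dbAddr_out h1, dbAddr_spine hb]
        -- The binder is a substitution of `S` itself. A variable in the body has the step `esL`
        -- replaced by `lam` on its path, which changes neither binders nor level.
        have key : ∃ d', dbAddr H.path S.path (b ++ .esL :: d) =
            H.path ++ .appL :: (b ++ .esL :: d') ∧ nb d' = nb d ∧ nl d' = nl d ∧
            kindAt (H.plug (.app (S.plug (.lam t)) v))
              (dbAddr H.path S.path (b ++ .esL :: d)) = some (.var (nb d)) := by
          rcases kindAt_db_cases h with ⟨q, h3, h4⟩ | ⟨q, h3, h4⟩ | ⟨-, h3⟩ | ⟨h3, h4⟩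
          · have h5 : d = r ++ .esL :: q := by
              rw [← hr] at h3
              simpa using h3
            refine ⟨r ++ .lam :: q, ?_, by simp [h5], by simp [h5], ?_⟩
            · rw [h3, dbAddr_body, ← hr]
              simp
            · rw [h3, dbAddr_body, kindAt_redex_body, h4]
          · have h5 : d = r ++ .esR :: q := by
              rw [← hr] at h3
              simpa using h3
            rw [kindAt_shift, Option.map_eq_some_iff] at h4
            obtain ⟨k', h6, h7⟩ := h4
            have h8 : S.binders = nb b + (1 + nb r) := by
              rw [← Ctx.nb_path, ← hr]; simp
            subst h5
            simp only [nb_append, nb_cons, binds_esR] at h7 ⊢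
            -- Impossible for a variable of the argument, since the shift by `S.binders` prevents
            -- capture by `S`.
            rcases Kind.lift_eq_var h7 with ⟨h9, -⟩ | ⟨h9, -⟩ <;> omega
          · simp at h3
          · exact ⟨d, by rw [dbAddr_out h3], rfl, rfl, by
              rw [dbAddr_out h3, kindAt_redex_appL, h4]⟩
        obtain ⟨d', h3, h4, h5, h6⟩ := key
        rw [h3, ← h4] at h6
        rw [h3]
        have h7 : H.path ++ .appL :: (b ++ .esL :: d') = (H.path ++ .appL :: b) ++ .esL :: d' := by
          simp
        rw [h7] at h6 ⊢
        simpa using (PFwd.sub _ _ Ln L T h6 (by omega)).reach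
    · have hk := kindAt_dbAddr H h (by rintro h'; exact hb ⟨_, h'⟩) fun i q hi hq => by
        cases hi
        exact bound_lt_of_not_spine hb rfl hq
      rw [dbAddr_append hb] at hk ⊢
      rw [dbAddr_append hb, dbTape_out (not_prefix_append hb _),
        dbTape_out (not_prefix_append hb _)]
      exact (PFwd.sub _ _ Ln L T hk hl).reach
  var_cross b z p Ln T hz h hl := by
    rw [kindAt_plug_append] at h
    have hp : ¬ p <+: S.path := fun hp => by
      have := kindAt_spine (t := t) (v := v.shift S.binders) hp hS
      rw [h] at this
      simp at this
    obtain ⟨d, h1, h2, h3⟩ := kindAt_dbAddr_cross H hS hH hz h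
    rw [dbTape_out hp]
    rw [h1] at h3 ⊢
    simpa using (PFwd.var b d Ln [] T h3 (by omega)).reach
  sub_cross b z p Ln T hz h hl := by
    rw [kindAt_plug_append] at h
    have hp : ¬ p <+: S.path := fun hp => by
      have := kindAt_spine (t := t) (v := v.shift S.binders) hp hS
      rw [h] at this
      simp at this
    obtain ⟨d, h1, h2, h3⟩ := kindAt_dbAddr_cross H hS hH hz h
    rw [dbTape_out hp]
    rw [h1] at h3 ⊢
    simpa using (PFwd.sub b d Ln [] T h3 (by omega)).reach

theorem runLength_lt_dB (H S : Ctx) (t v : Tm) (hH : H.level = 0) (hS : S.IsSubst) :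
    ∃ k, ∀ h, k ≤ h → runLength (H.plug (.app (S.plug (.lam t)) v)) h ≠ ⊤ →
      runLength (H.plug (S.plug (.es t (v.shift S.binders)))) h <
        runLength (H.plug (.app (S.plug (.lam t)) v)) h := by
  obtain ⟨k, hk⟩ := exists_kindAt_nil (S.plug (.es t (v.shift S.binders)))
  exact (Local.dB H S t v hH hS).runLength_lt (k₀ := k) (by rw [← hk, ← kindAt_plug H]; rfl)

end LIAM

theorem mainTheorem6 (t u : LIAM.Tm) (htu : LIAM.LinearHead t u) :
    ∃ k : ℕ, ∀ h : ℕ, k ≤ h → LIAM.runLength t h ≠ ⊤ →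
      LIAM.runLength u h < LIAM.runLength t h := by
  obtain ⟨H, a, b, hH, hab⟩ := htu
  cases hab with
  | dB S t u hS => exact LIAM.runLength_lt_dB H S t u hH hS
  | ls E t hE => exact LIAM.runLength_lt_ls H E t hH hE
  | gc t u => exact LIAM.runLength_lt_gc H _ u hH
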